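/- Let $d\ge 4$ and $s\ge d+2$ be integers. For real $A,X>0$ let $N(A,X)$ denote the number of solutions of $$\sum_{i=1}^{s}a_i(x_i^d-z_i^d)=\sum_{i=1}^{s}a_i(y_i^d-w_i^d)=0$$ in integers $a_i,x_i,y_i,z_i,w_i$ $(1\le i\le s)$ with $0<|a_i|\le A$ and $X/2\le |x_i|,|y_i|,|z_i|,|w_i|\le X$. Then for every $\varepsilon>0$ there is a constant $C>0$, depending only on $d$, $s$ and $\varepsilon$, such that for all real $A,X>0$ with $A\ge X^{2d}\ge 1$, $$N(A,X)\le C\left(A^sX^{2s}+A^{s-1}X^{3s-d+\varepsilon}+A^{s-2}X^{4s-2d+\varepsilon}E(X)\right),$$ where $$E(X)=1+X^{\frac12(5d+4-2s)}+X^{4d+4-2s}.$$ -/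

import Mathlib

namespace LatticeCount

/-- The integer solutions `(a, x, y, z, w)` of
`∑ aᵢ (xᵢ^d - zᵢ^d) = ∑ aᵢ (yᵢ^d - wᵢ^d) = 0` (with `s` summands)
such that `0 < |aᵢ| ≤ A` and `X / 2 ≤ |xᵢ|, |yᵢ|, |zᵢ|, |wᵢ| ≤ X` for every `i`. -/
def solutions (d s : ℕ) (A X : ℝ) :
    Set ((Fin s → ℤ) × (Fin s → ℤ) × (Fin s → ℤ) × (Fin s → ℤ) × (Fin s → ℤ)) :=
  {p | match p with
    | (a, x, y, z, w) =>
      (∀ i, 0 < |(a i : ℝ)| ∧ |(a i : ℝ)| ≤ A) ∧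
      (∀ i, X / 2 ≤ |(x i : ℝ)| ∧ |(x i : ℝ)| ≤ X) ∧
      (∀ i, X / 2 ≤ |(y i : ℝ)| ∧ |(y i : ℝ)| ≤ X) ∧
      (∀ i, X / 2 ≤ |(z i : ℝ)| ∧ |(z i : ℝ)| ≤ X) ∧
      (∀ i, X / 2 ≤ |(w i : ℝ)| ∧ |(w i : ℝ)| ≤ X) ∧
      ∑ i, a i * (x i ^ d - z i ^ d) = 0 ∧
      ∑ i, a i * (y i ^ d - w i ^ d) = 0}

/-- A set of integer vectors with bounded coordinates is finite. -/
theorem finite_box (s : ℕ) (B : ℝ) : {v : Fin s → ℤ | ∀ i, |(v i : ℝ)| ≤ B}.Finite := by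
  refine (Set.Finite.pi' (fun _ : Fin s => Set.finite_Icc (-⌈B⌉) ⌈B⌉)).subset ?_
  intro v hv i
  have h := abs_le.1 (hv i)
  have hB := Int.le_ceil B
  constructor
  · have : ((-⌈B⌉ : ℤ) : ℝ) ≤ v i := by push_cast; linarith [h.1]
    exact_mod_cast this
  · have : (v i : ℝ) ≤ (⌈B⌉ : ℤ) := by linarith [h.2]
    exact_mod_cast this

/-- There are only finitely many solutions, so that `Set.ncard` below is the true count. -/
theorem solutions_finite (d s : ℕ) (A X : ℝ) : (solutions d s A X).Finite := by
  refine ((finite_box s A).prod ((finite_box s X).prod ((finite_box s X).prod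
    ((finite_box s X).prod (finite_box s X))))).subset ?_
  rintro ⟨a, x, y, z, w⟩ ⟨ha, hx, hy, hz, hw, -, -⟩
  exact ⟨fun i => (ha i).2, fun i => (hx i).2, fun i => (hy i).2, fun i => (hz i).2,
    fun i => (hw i).2⟩

/-- The number `N(A, X)` of solutions. -/
noncomputable def N (d s : ℕ) (A X : ℝ) : ℕ := (solutions d s A X).ncard

/-- `E(X) = 1 + X^((5d+4-2s)/2) + X^(4d+4-2s)`, with real (possibly negative) exponents. -/
noncomputable def E (d s : ℕ) (X : ℝ) : ℝ :=
  1 + X ^ ((5 * (d : ℝ) + 4 - 2 * (s : ℝ)) / 2) + X ^ (4 * (d : ℝ) + 4 - 2 * (s : ℝ))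

end LatticeCount

/-! Once `x, y, z, w` are fixed, the equations are linear in `a`: with `c_k = (x_k^d - z_k^d, y_k^d
- w_k^d)` they say `∑ a_k c_k = 0`. So the count is of relations, with coefficients of size at most
`A`, among `s` vectors of `ℤ²`, summed over all families of vectors. There are three kinds of
families.

Solutions in which one component vanishes for every `k` are absorbed, by `(m + n)² ≤ 2m² + 2n²` for
each `a`, into the diagonal term `A^s X^(2s)` and the remaining kinds (`sum_sq_solutionPairs_le`).

If all `c_k` are parallel and neither component vanishes identically, one `c_k` has two nonzero
components and confines each of the other quadruples to about `X^(2+η)` choices, by the divisor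
bound. There are `O(A^(s-1))` relations, and `X^3 ≤ A` yields `A^s X^(2s)` again
(`sum_relations_of_minor_eq_zero_le`).

If the `c_k` span the plane, let `g` be the index of the lattice they generate and `Δ` a nonzero
minor. A packing argument gives `O(A^(s-2) g/|Δ|)` relations (`exists_index_card_relations_le`). For
`s ≤ 2d` the trivial bound `g ≤ |Δ|` is enough, since `X^(2s) ≤ A²`. For `s > 2d`, take `c_{i₀}`
longest and then `|Δ|` largest among the minors with `c_{i₀}`. Every vector is then constrained
twice. Modulo `g` it is parallel to the least divisible vector of the family, which leaves about
`X^4 (g^(-2/(3d)) + 1/X)` quadruples (`card_quads_dvd_minor_le`). It also lies in a strip of width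
governed by `|Δ|` (`card_quads_minor_le`). Raising the first bound to the power `s - 3` gains a full
factor `1/g`, which cancels `g`, and the strip bound makes the sum of `1/|Δ|` small
(`sum_inv_minor_le`). The outcome is `A^(s-2) X^ε (X^(3s+3) + X^(4s-2d))`, so the factor `E(X)` is
needed only through `E(X) ≥ 1`. -/

namespace LatticeCount

/-! ### Bounds for the number of divisors and of prime factors. -/

/-- The divisor bound. -/
theorem card_divisors_le_rpow (ε : ℝ) (hε : 0 < ε) :
    ∃ C : ℝ, 1 ≤ C ∧ ∀ n : ℕ, n ≠ 0 → (n.divisors.card : ℝ) ≤ C * (n : ℝ) ^ ε := by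
  set c : ℝ := max 1 (1 / (ε * Real.log 2)) with hc
  have hl : 0 < ε * Real.log 2 := mul_pos hε (Real.log_pos (by norm_num))
  have hc1 : 1 ≤ c := le_max_left _ _
  obtain ⟨P, hP⟩ := exists_nat_ge ((2 : ℝ) ^ (1 / ε))
  -- The ratio of the two sides is multiplicative. A prime below `P` costs at most a factor `c`, a
  -- larger one has `p ^ ε ≥ 2` and costs nothing; there are at most `P` small primes, hence the
  -- constant `c ^ P`.
  have small : ∀ v p : ℕ, 2 ≤ p → ((v : ℝ) + 1) ≤ c * ((p : ℝ) ^ ε) ^ v := by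
    intro v p hp
    have h1 : (2 : ℝ) ^ (ε * v) ≤ ((p : ℝ) ^ ε) ^ v := by
      rw [Real.rpow_mul (by norm_num), Real.rpow_natCast]
      have : (2 : ℝ) ≤ p := by exact_mod_cast hp
      gcongr
    have h2 : 1 + ε * Real.log 2 * v ≤ (2 : ℝ) ^ (ε * v) := by
      rw [Real.rpow_def_of_pos (by norm_num)]
      have := Real.add_one_le_exp (Real.log 2 * (ε * v))
      linarith
    have h3 : (v : ℝ) ≤ c * (ε * Real.log 2 * v) := by
      have : 1 / (ε * Real.log 2) ≤ c := le_max_right _ _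
      calc (v : ℝ) = 1 / (ε * Real.log 2) * (ε * Real.log 2 * v) := by field_simp
        _ ≤ _ := by gcongr
    nlinarith
  have large : ∀ v p : ℕ, P ≤ p → ((v : ℝ) + 1) ≤ ((p : ℝ) ^ ε) ^ v := by
    intro v p hp
    have h1 : (2 : ℝ) ≤ (p : ℝ) ^ ε := by
      have h : (2 : ℝ) ^ (1 / ε) ≤ p := hP.trans (by exact_mod_cast hp)
      calc (2 : ℝ) = ((2 : ℝ) ^ (1 / ε)) ^ ε := by
            rw [← Real.rpow_mul (by norm_num)]; field_simp; norm_num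
        _ ≤ _ := by gcongr
    have h2 : (v : ℝ) + 1 ≤ 2 ^ v := by exact_mod_cast Nat.lt_two_pow_self (n := v)
    exact h2.trans (by gcongr)
  refine ⟨c ^ P, one_le_pow₀ hc1, fun n hn => ?_⟩
  rw [Nat.card_divisors hn]
  push_cast
  have hn' : ((n : ℝ)) ^ ε = ∏ p ∈ n.primeFactors, ((p : ℝ) ^ ε) ^ (n.factorization p) := by
    conv_lhs => rw [← Nat.prod_factorization_pow_eq_self hn]
    rw [Nat.prod_factorization_eq_prod_primeFactors]
    push_cast
    rw [← Real.finsetProd_rpow _ _ (fun i _ => by positivity)]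
    refine Finset.prod_congr rfl fun p _ => ?_
    rw [← Real.rpow_natCast, ← Real.rpow_natCast, ← Real.rpow_mul (by positivity),
      ← Real.rpow_mul (by positivity), mul_comm]
  rw [hn']
  calc ∏ p ∈ n.primeFactors, ((n.factorization p : ℝ) + 1)
      ≤ ∏ p ∈ n.primeFactors, ((if p < P then c else 1) *
          ((p : ℝ) ^ ε) ^ (n.factorization p)) := by
        refine Finset.prod_le_prod (fun _ _ => by positivity) fun p hp => ?_
        split_ifs with h
        · exact small _ _ (Nat.prime_of_mem_primeFactors hp).two_le
        · rw [one_mul]; exact large _ _ (not_lt.1 h)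
    _ = (∏ p ∈ n.primeFactors, (if p < P then c else 1)) *
          ∏ p ∈ n.primeFactors, ((p : ℝ) ^ ε) ^ (n.factorization p) := Finset.prod_mul_distrib
    _ ≤ _ := by
        gcongr
        rw [← Finset.prod_filter, Finset.prod_const]
        refine pow_le_pow_right₀ hc1 ?_
        calc _ ≤ (Finset.range P).card := Finset.card_le_card (by
              intro p hp; simpa using (Finset.mem_filter.1 hp).2)
          _ = P := Finset.card_range P

theorem two_pow_card_primeFactors_le {n : ℕ} (hn : n ≠ 0) :
    2 ^ n.primeFactors.card ≤ n.divisors.card := by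
  rw [Nat.card_divisors hn, ← Finset.prod_const]
  refine Finset.prod_le_prod' fun p hp => ?_
  have := (Nat.prime_of_mem_primeFactors hp).factorization_pos_of_dvd hn
    (Nat.dvd_of_mem_primeFactors hp)
  omega

/-- Since `K ^ ω ≤ (2 ^ ω) ^ K ≤ τ ^ K`, the divisor bound with exponent `ε / (K + 1)` suffices; the
`+ 1` covers `K = 0`. -/
theorem pow_card_primeFactors_le_rpow (K : ℕ) (ε : ℝ) (hε : 0 < ε) :
    ∃ C : ℝ, 1 ≤ C ∧ ∀ n : ℕ, n ≠ 0 → ((K ^ n.primeFactors.card : ℕ) : ℝ) ≤ C * (n : ℝ) ^ ε := by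
  obtain ⟨C, hC1, hC⟩ := card_divisors_le_rpow (ε / (K + 1)) (by positivity)
  refine ⟨C ^ K, one_le_pow₀ hC1, fun n hn => ?_⟩
  have h1 : K ^ n.primeFactors.card ≤ n.divisors.card ^ K := calc
    K ^ n.primeFactors.card ≤ (2 ^ K) ^ n.primeFactors.card :=
        Nat.pow_le_pow_left Nat.lt_two_pow_self.le _
    _ = (2 ^ n.primeFactors.card) ^ K := by rw [← pow_mul, ← pow_mul, mul_comm]
    _ ≤ _ := Nat.pow_le_pow_left (two_pow_card_primeFactors_le hn) _
  have hn1 : (1 : ℝ) ≤ n := by exact_mod_cast Nat.one_le_iff_ne_zero.2 hn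
  calc ((K ^ n.primeFactors.card : ℕ) : ℝ) ≤ ((n.divisors.card ^ K : ℕ) : ℝ) := by
        exact_mod_cast h1
    _ = (n.divisors.card : ℝ) ^ K := by push_cast; rfl
    _ ≤ (C * (n : ℝ) ^ (ε / (K + 1))) ^ K := by gcongr; exact hC n hn
    _ = C ^ K * (n : ℝ) ^ (ε / (K + 1) * K) := by
        rw [mul_pow, ← Real.rpow_natCast ((n : ℝ) ^ _), ← Real.rpow_mul (by positivity)]
    _ ≤ C ^ K * (n : ℝ) ^ ε := by
        refine mul_le_mul_of_nonneg_left (Real.rpow_le_rpow_of_exponent_le hn1 ?_) (by positivity)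
        · rw [div_mul_eq_mul_div, div_le_iff₀ (by positivity)]
          nlinarith

/-! ### Roots of `w ^ d ≡ c` to a composite modulus. -/

/-- `d + 1` integers with `w ^ d ≡ c` modulo `p ^ j` cannot be pairwise incongruent
modulo `p ^ (t + 1)` when `d * t < j`. -/
theorem exists_dvd_sub_of_card {p d j t : ℕ} (hp : p.Prime) (hd : 0 < d) (hj : d * t < j)
    (c : ℤ) (S : Finset ℤ) (hS : S.card = d + 1) (hroot : ∀ w ∈ S, (p : ℤ) ^ j ∣ w ^ d - c) :
    ∃ w ∈ S, ∃ w' ∈ S, w ≠ w' ∧ (p : ℤ) ^ (t + 1) ∣ w - w' := by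
  by_contra! hne
  have := Fact.mk hp
  have hp1 : (1 : ℚ) < p := by exact_mod_cast hp.one_lt
  have hinj : Set.InjOn (fun w : ℤ => (w : ℚ)) S := Int.cast_injective.injOn
  -- Lagrange interpolation at `d + 1` nodes writes the leading coefficient `1` of `X ^ d - c` as a
  -- sum of values over products of `d` differences. If no difference is divisible by `p ^ (t + 1)`,
  -- each product has valuation at most `d * t < j`, so every term, and hence `1`, has `p`-adic norm
  -- below `1`.
  have hlead := Lagrange.leadingCoeff_eq_sum (s := S) (v := fun w : ℤ => (w : ℚ)) hinj
    (P := Polynomial.X ^ d - Polynomial.C (c : ℚ)) (by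
      rw [Polynomial.degree_X_pow_sub_C hd, hS]; push_cast; rfl)
  rw [(Polynomial.monic_X_pow_sub_C (c : ℚ) hd.ne').leadingCoeff] at hlead
  have hlt : padicNorm p (∑ i ∈ S, Polynomial.eval (i : ℚ)
      (Polynomial.X ^ d - Polynomial.C (c : ℚ)) / ∏ k ∈ S.erase i, ((i : ℚ) - k)) < 1 := by
    refine padicNorm.sum_lt' (fun i hi => ?_) one_pos
    have hnum : padicNorm p (Polynomial.eval (i : ℚ)
        (Polynomial.X ^ d - Polynomial.C (c : ℚ))) ≤ (p : ℚ) ^ (-(j : ℤ)) := by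
      have := (padicNorm.dvd_iff_norm_le (p := p) (n := j) (z := i ^ d - c)).1
        (by exact_mod_cast hroot i hi)
      simpa using this
    have hden : (p : ℚ) ^ (-((d * t : ℕ) : ℤ)) ≤ padicNorm p (∏ k ∈ S.erase i, ((i : ℚ) - k)) := by
      have hprod : padicNorm p (∏ k ∈ S.erase i, ((i : ℚ) - k))
          = ∏ k ∈ S.erase i, padicNorm p ((i : ℚ) - k) := by
        induction S.erase i using Finset.induction_on with
        | empty => simp
        | insert a s ha ih => rw [Finset.prod_insert ha, Finset.prod_insert ha, padicNorm.mul, ih]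
      rw [hprod]
      have hcard : (S.erase i).card = d := by rw [Finset.card_erase_of_mem hi, hS]; simp
      calc (p : ℚ) ^ (-((d * t : ℕ) : ℤ)) = ∏ k ∈ S.erase i, (p : ℚ) ^ (-(t : ℤ)) := by
            rw [Finset.prod_const, hcard, ← zpow_natCast, ← zpow_mul]
            congr 1; push_cast; ring
        _ ≤ _ := by
            refine Finset.prod_le_prod (fun _ _ => by positivity) fun k hk => ?_
            have hk' := Finset.mem_erase.1 hk
            have hz : (i - k : ℤ) ≠ 0 := sub_ne_zero.2 hk'.1.symm
            have hnd := hne i hi k hk'.2 hk'.1.symm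
            rw [padicValInt_dvd_iff] at hnd
            push Not at hnd
            have hq : ((i : ℚ) - k) ≠ 0 := by exact_mod_cast hz
            rw [padicNorm.eq_zpow_of_nonzero hq]
            refine zpow_le_zpow_right₀ hp1.le ?_
            have : padicValRat p ((i : ℚ) - k) = padicValInt p (i - k) := by
              rw [← padicValRat.of_int]; push_cast; rfl
            rw [this]; omega
    have hpos : (0 : ℚ) < (p : ℚ) ^ (-((d * t : ℕ) : ℤ)) := by positivity
    rw [padicNorm.div, div_lt_one (hpos.trans_le hden)]
    refine hnum.trans_lt (lt_of_lt_of_le ?_ hden)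
    exact zpow_lt_zpow_right₀ hp1 (by omega)
  rw [← hlead, padicNorm.one] at hlt
  exact lt_irrefl _ hlt

/-- The integers with `w ^ d ≡ c` modulo `q` lie in at most `d ^ ω(q)` residue classes modulo
some `r ∣ q` with `q ≤ r ^ d`. -/
theorem exists_modulus_card_classes_le {d : ℕ} (hd : 0 < d) (q : ℕ) (hq : q ≠ 0) :
    ∃ r : ℕ, r ∣ q ∧ q ≤ r ^ d ∧ ∀ (c : ℤ) (S : Finset ℤ), (∀ w ∈ S, (q : ℤ) ∣ w ^ d - c) →
      (S.image (· % (r : ℤ))).card ≤ d ^ q.primeFactors.card := by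
  induction q using Nat.recOnPosPrimePosCoprime with
  | zero => exact absurd rfl hq
  | one =>
    refine ⟨1, dvd_rfl, by simp, fun c S _ => ?_⟩
    simp only [Nat.cast_one, Int.emod_one, Nat.primeFactors_one, Finset.card_empty, pow_zero]
    exact Finset.card_le_one.2 (by simp)
  | prime_pow p j hp hj =>
    -- Here `t + 1 = ⌈j / d⌉`, the least exponent with `p ^ j ≤ (p ^ (t + 1)) ^ d`.
    obtain ⟨t, ht1, ht2⟩ : ∃ t, d * t < j ∧ j ≤ d * (t + 1) := by
      refine ⟨(j - 1) / d, ?_, ?_⟩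
      · have := Nat.mul_div_le (j - 1) d; omega
      · have := Nat.lt_mul_div_succ (j - 1) hd; omega
    refine ⟨p ^ (t + 1), pow_dvd_pow _ ?_, ?_, fun c S hS => ?_⟩
    · have : t ≤ d * t := Nat.le_mul_of_pos_left _ hd
      omega
    · rw [← pow_mul]; exact Nat.pow_le_pow_right hp.pos (by rw [mul_comm]; exact ht2)
    rw [Nat.primeFactors_prime_pow hj.ne' hp, Finset.card_singleton, pow_one]
    by_contra! hcard
    obtain ⟨T, hTS, hT⟩ := Finset.exists_subset_card_eq (Nat.succ_le_of_lt hcard)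
    -- One representative from each of `d + 1` distinct classes.
    obtain ⟨U, hUS, hinj, hU⟩ := Finset.exists_subset_injOn_image_eq_of_surjOn (s := (S : Set ℤ))
      (t := T) (f := (· % ((p ^ (t + 1) : ℕ) : ℤ))) (by
      intro x hx; simpa using hTS hx)
    have hUc : U.card = d + 1 := by
      rw [← Finset.card_image_of_injOn hinj, hU, hT]
    obtain ⟨w, hw, w', hw', hne, hdvd⟩ := exists_dvd_sub_of_card hp hd ht1 c U hUc
      (fun w hw => by have := hS w (hUS hw); push_cast at this; exact this)
    refine hne (hinj hw hw' ?_)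
    exact (Int.modEq_iff_dvd.2 (by push_cast; exact hdvd)).symm
  | coprime a b ha hb hab iha ihb =>
    obtain ⟨r, hra, har, hr⟩ := iha (by omega)
    obtain ⟨s, hsb, hbs, hs⟩ := ihb (by omega)
    have hrs : r.Coprime s := Nat.Coprime.coprime_dvd_left hra (hab.coprime_dvd_right hsb)
    refine ⟨r * s, mul_dvd_mul hra hsb, by rw [mul_pow]; exact Nat.mul_le_mul har hbs,
      fun c S hS => ?_⟩
    have h1 := hr c S fun w hw => (by push_cast; exact dvd_mul_right _ _ : (a : ℤ) ∣ ((a * b : ℕ) : ℤ)).trans (hS w hw)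
    have h2 := hs c S fun w hw => (by push_cast; exact dvd_mul_left _ _ : (b : ℤ) ∣ ((a * b : ℕ) : ℤ)).trans (hS w hw)
    rw [hab.primeFactors_mul, Finset.card_union_of_disjoint hab.disjoint_primeFactors, pow_add]
    refine le_trans ?_ (Nat.mul_le_mul h1 h2)
    rw [← Finset.card_product]
    -- Chinese remainder theorem: a class modulo `r * s` is determined by its two reductions.
    refine Finset.card_le_card_of_injOn (fun x => (x % (r : ℤ), x % (s : ℤ))) ?_ ?_
    · intro x hx
      obtain ⟨w, hw, rfl⟩ := Finset.mem_image.1 hx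
      simp only [Finset.coe_product, Set.mem_prod, Finset.mem_coe, Finset.mem_image]
      refine ⟨⟨w, hw, ?_⟩, ⟨w, hw, ?_⟩⟩
      · exact (Int.emod_emod_of_dvd w (by push_cast; exact dvd_mul_right _ _)).symm
      · exact (Int.emod_emod_of_dvd w (by push_cast; exact dvd_mul_left _ _)).symm
    · intro x hx y hy hxy
      obtain ⟨w, hw, rfl⟩ := Finset.mem_image.1 hx
      obtain ⟨w', hw', rfl⟩ := Finset.mem_image.1 hy
      simp only [Prod.mk.injEq] at hxy
      rw [Int.emod_emod_of_dvd _ (by push_cast; exact dvd_mul_right _ _),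
        Int.emod_emod_of_dvd _ (by push_cast; exact dvd_mul_right _ _),
        Int.emod_emod_of_dvd _ (by push_cast; exact dvd_mul_left _ _),
        Int.emod_emod_of_dvd _ (by push_cast; exact dvd_mul_left _ _)] at hxy
      have := (Int.modEq_and_modEq_iff_modEq_mul (a := w) (b := w') (m := r) (n := s)
        (by simpa using hrs)).1 hxy
      push_cast
      exact this

/-! ### Counting in the annulus, in residue classes and among roots of congruences. -/

/-- The integers `x` with `X / 2 ≤ |x| ≤ X`. -/
noncomputable def annulus (X : ℝ) : Finset ℤ :=
  (Finset.Icc (-⌊X⌋) ⌊X⌋).filter fun x => X / 2 ≤ |(x : ℝ)|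

theorem mem_annulus {X : ℝ} {x : ℤ} : x ∈ annulus X ↔ X / 2 ≤ |(x : ℝ)| ∧ |(x : ℝ)| ≤ X := by
  rw [annulus, Finset.mem_filter, Finset.mem_Icc, ← abs_le, Int.le_floor, and_comm]
  push_cast; rfl

theorem card_Icc_floor_le {X : ℝ} (hX : 1 ≤ X) :
    ((Finset.Icc (-⌊X⌋) ⌊X⌋).card : ℝ) ≤ 3 * X := by
  have h0 : 0 ≤ ⌊X⌋ := Int.floor_nonneg.2 (by linarith)
  have h : ((Finset.Icc (-⌊X⌋) ⌊X⌋).card : ℤ) = 2 * ⌊X⌋ + 1 := by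
    rw [Int.card_Icc]; omega
  have h' : ((Finset.Icc (-⌊X⌋) ⌊X⌋).card : ℝ) = 2 * ⌊X⌋ + 1 := by exact_mod_cast h
  rw [h']
  linarith [Int.floor_le X]

theorem card_annulus_le {X : ℝ} (hX : 1 ≤ X) : ((annulus X).card : ℝ) ≤ 3 * X :=
  (by exact_mod_cast Finset.card_filter_le _ _ :
    ((annulus X).card : ℝ) ≤ ((Finset.Icc (-⌊X⌋) ⌊X⌋).card : ℝ)).trans (card_Icc_floor_le hX)

theorem card_annulus_class_le {X : ℝ} (hX : 1 ≤ X) {r : ℕ} (hr : 0 < r) (v : ℤ) :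
    (((annulus X).filter fun w => w % (r : ℤ) = v).card : ℝ) ≤ 3 * X / r + 1 := by
  have hr' : (0 : ℤ) < r := by exact_mod_cast hr
  have hsub : ((annulus X).filter fun w => w % (r : ℤ) = v) ⊆
      (Finset.Ioc (-⌊X⌋ - 1) ⌊X⌋).filter (fun w => w ≡ v [ZMOD r]) := by
    intro w hw
    rw [Finset.mem_filter] at hw ⊢
    have h1 := Finset.mem_Icc.1 (Finset.mem_filter.1 hw.1).1
    refine ⟨Finset.mem_Ioc.2 ⟨by omega, h1.2⟩, ?_⟩
    rw [← hw.2]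
    exact (Int.mod_modEq w r).symm
  have h2 := Int.Ioc_filter_modEq_card (-⌊X⌋ - 1) ⌊X⌋ hr' v
  have h0 : 0 ≤ ⌊X⌋ := Int.floor_nonneg.2 (by linarith)
  have h3 : (((annulus X).filter fun w => w % (r : ℤ) = v).card : ℝ) ≤
      (((Finset.Ioc (-⌊X⌋ - 1) ⌊X⌋).filter (fun w => w ≡ v [ZMOD r])).card : ℝ) := by
    exact_mod_cast Finset.card_le_card hsub
  refine h3.trans ?_
  have h4 : (((Finset.Ioc (-⌊X⌋ - 1) ⌊X⌋).filter (fun w => w ≡ v [ZMOD r])).card : ℝ) =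
      max (((⌊((⌊X⌋ - v : ℤ) : ℚ) / (r : ℤ)⌋ - ⌊((-⌊X⌋ - 1 - v : ℤ) : ℚ) / (r : ℤ)⌋ : ℤ)) : ℝ) 0 := by
    have := congrArg (fun z : ℤ => (z : ℝ)) h2
    simpa using this
  rw [h4]
  have hrR : (0 : ℝ) < r := by exact_mod_cast hr
  refine max_le ?_ (by positivity)
  have e1 : ((⌊((⌊X⌋ - v : ℤ) : ℚ) / (r : ℤ)⌋ : ℤ) : ℚ) ≤ ((⌊X⌋ - v : ℤ) : ℚ) / (r : ℤ) :=
    Int.floor_le _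
  have e2 : ((-⌊X⌋ - 1 - v : ℤ) : ℚ) / (r : ℤ) <
      (⌊((-⌊X⌋ - 1 - v : ℤ) : ℚ) / (r : ℤ)⌋ : ℤ) + 1 := Int.lt_floor_add_one _
  have e3 : ((⌊((⌊X⌋ - v : ℤ) : ℚ) / (r : ℤ)⌋ - ⌊((-⌊X⌋ - 1 - v : ℤ) : ℚ) / (r : ℤ)⌋ : ℤ) : ℚ) ≤
      (2 * ⌊X⌋ + 1) / (r : ℚ) + 1 := by
    have : ((⌊X⌋ - v : ℤ) : ℚ) / (r : ℤ) - ((-⌊X⌋ - 1 - v : ℤ) : ℚ) / (r : ℤ) =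
        (2 * ⌊X⌋ + 1) / (r : ℚ) := by push_cast; ring
    push_cast at *
    linarith
  have e4 : ((⌊((⌊X⌋ - v : ℤ) : ℚ) / (r : ℤ)⌋ - ⌊((-⌊X⌋ - 1 - v : ℤ) : ℚ) / (r : ℤ)⌋ : ℤ) : ℝ) ≤
      (2 * ⌊X⌋ + 1) / (r : ℝ) + 1 := by exact_mod_cast e3
  refine e4.trans ?_
  gcongr
  linarith [Int.floor_le X]

/-- There are few solutions of `w ^ d ≡ c` modulo `q` in an interval. -/
theorem card_annulus_roots_le {d : ℕ} (hd : 0 < d) {q : ℕ} (hq : q ≠ 0) {X : ℝ} (hX : 1 ≤ X)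
    (c : ℤ) : (((annulus X).filter fun w => (q : ℤ) ∣ w ^ d - c).card : ℝ) ≤
      (d ^ q.primeFactors.card : ℕ) * (3 * X * (q : ℝ) ^ (-(1 / d : ℝ)) + 1) := by
  obtain ⟨r, hrq, hqr, hr⟩ := exists_modulus_card_classes_le hd q hq
  have hr0 : 0 < r := Nat.pos_of_dvd_of_pos hrq (Nat.pos_of_ne_zero hq)
  set S := (annulus X).filter fun w => (q : ℤ) ∣ w ^ d - c with hS
  have h1 := hr c S fun w hw => (Finset.mem_filter.1 hw).2
  have hrR : (0 : ℝ) < r := by exact_mod_cast hr0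
  have hqR : (0 : ℝ) < q := by exact_mod_cast Nat.pos_of_ne_zero hq
  have hinv : 1 / (r : ℝ) ≤ (q : ℝ) ^ (-(1 / d : ℝ)) := by
    rw [Real.rpow_neg hqR.le, one_div]
    refine inv_anti₀ (by positivity) ?_
    calc (q : ℝ) ^ (1 / d : ℝ) ≤ ((r : ℝ) ^ d) ^ (1 / d : ℝ) := by
          gcongr; exact_mod_cast hqr
      _ = r := by
          rw [one_div]; exact Real.pow_rpow_inv_natCast hrR.le hd.ne'
  have h2 : (S.card : ℝ) ≤ ∑ v ∈ S.image (· % (r : ℤ)), (3 * X / r + 1) := by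
    rw [Finset.card_eq_sum_card_image (· % (r : ℤ)) S]
    push_cast
    refine Finset.sum_le_sum fun v _ => ?_
    refine le_trans ?_ (card_annulus_class_le hX hr0 v)
    exact_mod_cast Finset.card_le_card
      (Finset.filter_subset_filter _ (Finset.filter_subset _ _))
  rw [Finset.sum_const, nsmul_eq_mul] at h2
  refine h2.trans ?_
  have : 3 * X / r = 3 * X * (1 / r) := by ring
  rw [this]
  gcongr

/-! ### Pairs, quadruples, their vectors and minors. -/

/-- The integer `x ^ d - z ^ d` attached to the pair `(x, z)`. -/
def powDiff (d : ℕ) (p : ℤ × ℤ) : ℤ := p.1 ^ d - p.2 ^ d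

/-- Pairs of integers from the annulus. -/
noncomputable def pairs (X : ℝ) : Finset (ℤ × ℤ) := annulus X ×ˢ annulus X

/-- Quadruples of integers from the annulus. -/
noncomputable def quads (X : ℝ) : Finset ((ℤ × ℤ) × (ℤ × ℤ)) := pairs X ×ˢ pairs X

/-- The determinant of the two vectors `(x ^ d - z ^ d, y ^ d - w ^ d)` given by two quadruples. -/
def minor (d : ℕ) (p q : (ℤ × ℤ) × (ℤ × ℤ)) : ℤ :=
  powDiff d p.1 * powDiff d q.2 - powDiff d p.2 * powDiff d q.1

theorem card_filter_product_le {α β : Type*} (s : Finset α) (t : Finset β) (P : α → β → Prop)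
    [∀ a, DecidablePred (P a)] [DecidablePred fun x : α × β => P x.1 x.2] {S K : ℝ} (hK0 : 0 ≤ K)
    (hS : (s.card : ℝ) ≤ S)
    (hK : ∀ a ∈ s, ((t.filter (P a)).card : ℝ) ≤ K) :
    (((s ×ˢ t).filter fun x => P x.1 x.2).card : ℝ) ≤ S * K := by
  classical
  have h1 : ((s ×ˢ t).filter fun x => P x.1 x.2).card = ∑ a ∈ s, (t.filter (P a)).card := by
    rw [← Finset.card_sigma]
    refine Finset.card_bij (fun x _ => ⟨x.1, x.2⟩) ?_ ?_ ?_
    · intro x hx; simp at hx ⊢; tauto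
    · rintro ⟨a, b⟩ _ ⟨a', b'⟩ _ h; simpa using h
    · rintro ⟨a, b⟩ h; exact ⟨(a, b), by simp at h ⊢; tauto, rfl⟩
  rw [h1]; push_cast
  calc ∑ a ∈ s, ((t.filter (P a)).card : ℝ) ≤ ∑ a ∈ s, K := Finset.sum_le_sum hK
    _ = s.card * K := by rw [Finset.sum_const, nsmul_eq_mul]
    _ ≤ _ := by gcongr

theorem card_filter_product_le' {α β : Type*} (s : Finset α) (t : Finset β) (P : α → β → Prop)
    [∀ b, DecidablePred fun a => P a b] [DecidablePred fun x : α × β => P x.1 x.2]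
    {T K : ℝ} (hK0 : 0 ≤ K) (hT : (t.card : ℝ) ≤ T)
    (hK : ∀ b ∈ t, ((s.filter fun a => P a b).card : ℝ) ≤ K) :
    (((s ×ˢ t).filter fun x => P x.1 x.2).card : ℝ) ≤ T * K := by
  classical
  refine le_trans ?_ (card_filter_product_le t s (fun b a => P a b) hK0 hT hK)
  norm_cast
  refine Finset.card_le_card_of_injOn Prod.swap ?_ Prod.swap_injective.injOn
  intro x hx
  simp at hx ⊢; tauto

theorem card_pairs_le {X : ℝ} (hX : 1 ≤ X) : ((pairs X).card : ℝ) ≤ 9 * X ^ 2 := by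
  rw [pairs, Finset.card_product]; push_cast
  have := card_annulus_le hX
  calc _ ≤ (3 * X) * (3 * X) := by gcongr
    _ = _ := by ring

theorem card_quads_le {X : ℝ} (hX : 1 ≤ X) : ((quads X).card : ℝ) ≤ 81 * X ^ 4 := by
  rw [quads, Finset.card_product]; push_cast
  have := card_pairs_le hX
  calc _ ≤ (9 * X ^ 2) * (9 * X ^ 2) := by gcongr
    _ = _ := by ring

/-! ### Quadruples under divisibility conditions. -/

/-- Allows one weight `d ^ ω(g)` to serve for every divisor of `g` that occurs below. -/
theorem pow_card_primeFactors_mono {d b g : ℕ} (hd : 0 < d) (hg : g ≠ 0) (h : b ∣ g) :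
    d ^ b.primeFactors.card ≤ d ^ g.primeFactors.card :=
  Nat.pow_le_pow_right hd (Finset.card_le_card (Nat.primeFactors_mono h hg))

theorem card_pairs_dvd_le {d : ℕ} (hd : 0 < d) {X : ℝ} (hX : 1 ≤ X) {g b : ℕ} (hg : g ≠ 0)
    (hb : b ∣ g) : (((pairs X).filter fun p => (b : ℤ) ∣ powDiff d p).card : ℝ) ≤
      3 * X * ((d ^ g.primeFactors.card : ℕ) * (3 * X * (b : ℝ) ^ (-(1 / d : ℝ)) + 1)) := by
  have hb0 : b ≠ 0 := ne_zero_of_dvd_ne_zero hg hb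
  refine card_filter_product_le _ _ (fun x z : ℤ => (b : ℤ) ∣ x ^ d - z ^ d) (by positivity)
    (card_annulus_le hX) fun x _ => ?_
  have h := card_annulus_roots_le hd hb0 hX (x ^ d)
  have h' := pow_card_primeFactors_mono hd hg hb
  simp_rw [fun z : ℤ => dvd_sub_comm (a := (b : ℤ)) (b := x ^ d) (c := z ^ d)]
  refine h.trans ?_
  gcongr

/-- Subtracting one fixed solution `w₀` removes `e`; cancelling `gcd(f, α)` then leaves `w ^ d ≡ w₀
^ d` modulo `f / gcd(f, α)`. -/
theorem card_annulus_linear_dvd_le {d : ℕ} (hd : 0 < d) {X : ℝ} (hX : 1 ≤ X) {g f : ℕ}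
    (hg : g ≠ 0) (hf : f ∣ g) (α e : ℤ) :
    (((annulus X).filter fun w => (f : ℤ) ∣ α * w ^ d - e).card : ℝ) ≤
      (d ^ g.primeFactors.card : ℕ) *
        (3 * X * ((f / Int.gcd f α : ℕ) : ℝ) ^ (-(1 / d : ℝ)) + 1) := by
  have hf0 : f ≠ 0 := ne_zero_of_dvd_ne_zero hg hf
  set b := Int.gcd f α with hb
  have hbf : b ∣ f := by
    have := Int.gcd_dvd_left (a := (f : ℤ)) (b := α); exact_mod_cast this
  have hb0 : 0 < b := Nat.pos_of_dvd_of_pos hbf (Nat.pos_of_ne_zero hf0)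
  have hf' : f / b ∣ f := Nat.div_dvd_of_dvd hbf
  have hf'0 : f / b ≠ 0 := (Nat.div_pos (Nat.le_of_dvd (Nat.pos_of_ne_zero hf0) hbf) hb0).ne'
  rcases ((annulus X).filter fun w => (f : ℤ) ∣ α * w ^ d - e).eq_empty_or_nonempty with h | ⟨w₀, h⟩
  · rw [h]; simp only [Finset.card_empty, Nat.cast_zero]; positivity
  have hw₀ := (Finset.mem_filter.1 h).2
  have h1 := card_annulus_roots_le hd hf'0 hX (w₀ ^ d)
  have h2 := pow_card_primeFactors_mono hd hg (hf'.trans hf)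
  calc _ ≤ (((annulus X).filter fun w => ((f / b : ℕ) : ℤ) ∣ w ^ d - w₀ ^ d).card : ℝ) := by
        norm_cast
        refine Finset.card_le_card fun w hw => ?_
        rw [Finset.mem_filter] at hw ⊢
        refine ⟨hw.1, ?_⟩
        have h3 : (f : ℤ) ∣ α * (w ^ d - w₀ ^ d) := by
          have := dvd_sub hw.2 hw₀
          rwa [show α * w ^ d - e - (α * w₀ ^ d - e) = α * (w ^ d - w₀ ^ d) by ring] at this
        have h4 := Int.dvd_of_dvd_mul_right_of_gcd_one
          (a := (f : ℤ) / b) (b := α / b) (c := w ^ d - w₀ ^ d) ?_ ?_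
        · rwa [Int.natCast_div]
        · have hbα : (b : ℤ) ∣ α := Int.gcd_dvd_right ..
          have hbf' : (b : ℤ) ∣ f := Int.gcd_dvd_left ..
          refine (mul_dvd_mul_iff_left (a := (b : ℤ)) (by exact_mod_cast hb0.ne')).1 ?_
          rw [Int.mul_ediv_cancel' hbf', ← mul_assoc, Int.mul_ediv_cancel' hbα]
          exact h3
        · exact Int.gcd_ediv_gcd_ediv_gcd (by rw [← hb]; exact hb0)
    _ ≤ _ := h1
    _ ≤ _ := by gcongr

theorem rpow_neg_mul_rpow_neg {f b : ℕ} (hbf : b ∣ f) (e : ℝ) :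
    (b : ℝ) ^ e * ((f / b : ℕ) : ℝ) ^ e = (f : ℝ) ^ e := by
  rw [← Real.mul_rpow (by positivity) (by positivity)]
  congr 1
  exact_mod_cast Nat.mul_div_cancel' hbf

/-- With `b = gcd(f, α)`, which is prime to `β`, the congruence forces `b` to divide the first
component, saving `b ^ (-1/d)`. Given that component, the second is determined modulo `f / b`,
saving `(f / b) ^ (-1/d)`. The savings multiply to `f ^ (-1/d)`. -/
theorem card_quads_linear_dvd_le {d : ℕ} (hd : 0 < d) {X : ℝ} (hX : 1 ≤ X) {g f : ℕ}
    (hg : g ≠ 0) (hf : f ∣ g) (α β : ℤ) (hco : Nat.gcd f (Int.gcd α β) = 1) :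
    (((quads X).filter fun q => (f : ℤ) ∣ α * powDiff d q.2 - β * powDiff d q.1).card : ℝ) ≤
      81 * X ^ 4 * (d ^ g.primeFactors.card : ℕ) ^ 2 * ((f : ℝ) ^ (-(1 / d : ℝ)) + 1 / X) := by
  have hf0 : f ≠ 0 := ne_zero_of_dvd_ne_zero hg hf
  set D : ℝ := ((d ^ g.primeFactors.card : ℕ) : ℝ) with hD
  have hD0 : 0 ≤ D := by positivity
  set b := Int.gcd f α with hb
  have hbf : b ∣ f := by
    have := Int.gcd_dvd_left (a := (f : ℤ)) (b := α); exact_mod_cast this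
  have hb0 : 0 < b := Nat.pos_of_dvd_of_pos hbf (Nat.pos_of_ne_zero hf0)
  have hbα : (b : ℤ) ∣ α := Int.gcd_dvd_right ..
  set B : ℝ := (b : ℝ) ^ (-(1 / d : ℝ)) with hB
  set F : ℝ := ((f / b : ℕ) : ℝ) ^ (-(1 / d : ℝ)) with hF
  have hBF : B * F = (f : ℝ) ^ (-(1 / d : ℝ)) := rpow_neg_mul_rpow_neg hbf _
  have hB0 : 0 ≤ B := by positivity
  have hF0 : 0 ≤ F := by positivity
  have hfb1 : (1 : ℝ) ≤ ((f / b : ℕ) : ℝ) := by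
    exact_mod_cast Nat.div_pos (Nat.le_of_dvd (Nat.pos_of_ne_zero hf0) hbf) hb0
  have hB1 : B ≤ 1 := Real.rpow_le_one_of_one_le_of_nonpos (by exact_mod_cast hb0)
    (by rw [neg_nonpos]; positivity)
  have hF1 : F ≤ 1 := Real.rpow_le_one_of_one_le_of_nonpos hfb1 (by rw [neg_nonpos]; positivity)
  have hbu : ∀ q : (ℤ × ℤ) × (ℤ × ℤ),
      (f : ℤ) ∣ α * powDiff d q.2 - β * powDiff d q.1 → (b : ℤ) ∣ powDiff d q.1 := by
    intro q hq
    have h1 : (b : ℤ) ∣ β * powDiff d q.1 := by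
      have h2 : (b : ℤ) ∣ α * powDiff d q.2 - β * powDiff d q.1 :=
        (Int.natCast_dvd_natCast.2 hbf).trans hq
      exact (dvd_sub_right (dvd_mul_of_dvd_left hbα _)).1 h2
    refine Int.dvd_of_dvd_mul_right_of_gcd_one h1 ?_
    have h3 : Int.gcd b β ∣ Nat.gcd f (Int.gcd α β) := by
      have h4 : ((Int.gcd b β : ℕ) : ℤ) ∣ b := Int.gcd_dvd_left ..
      refine Nat.dvd_gcd ((Int.natCast_dvd_natCast.1 h4).trans hbf) ?_
      exact Int.dvd_gcd (h4.trans hbα) (Int.gcd_dvd_right ..)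
    rw [hco] at h3
    exact Nat.dvd_one.1 h3
  have h1 : (((quads X).filter fun q =>
      (f : ℤ) ∣ α * powDiff d q.2 - β * powDiff d q.1).card : ℝ) ≤
      (3 * X * (D * (3 * X * B + 1))) * ((3 * X) * (D * (3 * X * F + 1))) := by
    calc _ ≤ (((((pairs X).filter fun p => (b : ℤ) ∣ powDiff d p) ×ˢ pairs X).filter fun q =>
          (f : ℤ) ∣ α * powDiff d q.2 - β * powDiff d q.1).card : ℝ) := by
          norm_cast
          refine Finset.card_le_card fun q hq => ?_
          rw [Finset.mem_filter, quads, Finset.mem_product] at hq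
          rw [Finset.mem_filter, Finset.mem_product, Finset.mem_filter]
          exact ⟨⟨⟨hq.1.1, hbu q hq.2⟩, hq.1.2⟩, hq.2⟩
      _ ≤ _ := by
          refine card_filter_product_le _ _
            (fun p p' : ℤ × ℤ => (f : ℤ) ∣ α * powDiff d p' - β * powDiff d p) (by positivity)
            (card_pairs_dvd_le hd hX hg (hbf.trans hf)) fun p _ => ?_
          refine card_filter_product_le _ _
            (fun y w : ℤ => (f : ℤ) ∣ α * (y ^ d - w ^ d) - β * powDiff d p) (by positivity)
            (card_annulus_le hX) fun y _ => ?_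
          have h := card_annulus_linear_dvd_le hd hX hg hf α (α * y ^ d - β * powDiff d p)
          refine le_trans (le_of_eq ?_) h
          congr 2
          refine Finset.filter_congr fun w _ => ?_
          rw [← dvd_neg]
          ring_nf
  refine h1.trans ?_
  have hX0 : 0 < X := by linarith
  rw [← hBF]
  have e : 81 * X ^ 4 * D ^ 2 * (B * F + 1 / X) = 9 * X ^ 2 * D ^ 2 * (9 * X ^ 2 * (B * F) + 9 * X) := by
    field_simp
    ring
  rw [e]
  -- The cross terms and the final `1` are at most `7 * X`, because `B, F ≤ 1 ≤ X`.
  have : (3 * X * B + 1) * (3 * X * F + 1) ≤ 9 * X ^ 2 * (B * F) + 9 * X := by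
    nlinarith [mul_le_mul_of_nonneg_left hB1 hX0.le, mul_le_mul_of_nonneg_left hF1 hX0.le]
  calc _ = 9 * X ^ 2 * D ^ 2 * ((3 * X * B + 1) * (3 * X * F + 1)) := by ring
    _ ≤ _ := by gcongr

/-- The greatest common divisor of `g` with the two components of the vector of a quadruple. -/
def gcdVec (d g : ℕ) (q : (ℤ × ℤ) × (ℤ × ℤ)) : ℕ :=
  Nat.gcd g (Int.gcd (powDiff d q.1) (powDiff d q.2))

/-- Union bound over the value `b` of the gcd, a divisor of `g` with `b ≥ h`. Both components are
divisible by `b` independently, so the saving `h ^ (-1/d)` is squared. -/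
theorem card_quads_gcdVec_ge_le {d : ℕ} (hd : 0 < d) {X : ℝ} (hX : 1 ≤ X) {g h : ℕ}
    (hg : g ≠ 0) (hh : 0 < h) :
    (((quads X).filter fun q => h ≤ gcdVec d g q).card : ℝ) ≤
      g.divisors.card * (81 * X ^ 4 * (d ^ g.primeFactors.card : ℕ) ^ 2 *
        (2 * (h : ℝ) ^ (-(2 / d : ℝ)) + 1 / X)) := by
  classical
  set D : ℝ := ((d ^ g.primeFactors.card : ℕ) : ℝ) with hD
  have hX0 : 0 < X := by linarith
  have hsub : ((quads X).filter fun q => h ≤ gcdVec d g q) ⊆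
      (g.divisors.filter (h ≤ ·)).biUnion fun b =>
        ((pairs X).filter fun p => (b : ℤ) ∣ powDiff d p) ×ˢ
          ((pairs X).filter fun p => (b : ℤ) ∣ powDiff d p) := by
    intro q hq
    rw [Finset.mem_filter, quads, Finset.mem_product] at hq
    have h1 : gcdVec d g q ∣ Int.gcd (powDiff d q.1) (powDiff d q.2) := Nat.gcd_dvd_right _ _
    have h2 : ((gcdVec d g q : ℕ) : ℤ) ∣ (Int.gcd (powDiff d q.1) (powDiff d q.2) : ℕ) :=
      Int.natCast_dvd_natCast.2 h1
    simp only [Finset.mem_biUnion, Finset.mem_filter, Nat.mem_divisors, Finset.mem_product]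
    exact ⟨gcdVec d g q, ⟨⟨Nat.gcd_dvd_left _ _, hg⟩, hq.2⟩,
      ⟨hq.1.1, h2.trans (Int.gcd_dvd_left ..)⟩, ⟨hq.1.2, h2.trans (Int.gcd_dvd_right ..)⟩⟩
  have hcard : (((quads X).filter fun q => h ≤ gcdVec d g q).card : ℝ) ≤
      ∑ b ∈ g.divisors.filter (h ≤ ·), ((((pairs X).filter fun p => (b : ℤ) ∣ powDiff d p) ×ˢ
          ((pairs X).filter fun p => (b : ℤ) ∣ powDiff d p)).card : ℝ) := by
    exact_mod_cast (Finset.card_le_card hsub).trans Finset.card_biUnion_le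
  refine hcard.trans ?_
  calc _ ≤ ∑ b ∈ g.divisors.filter (h ≤ ·), 81 * X ^ 4 * D ^ 2 *
        (2 * (h : ℝ) ^ (-(2 / d : ℝ)) + 1 / X) := by
        refine Finset.sum_le_sum fun b hb => ?_
        rw [Finset.mem_filter, Nat.mem_divisors] at hb
        rw [Finset.card_product]
        push_cast
        have h1 := card_pairs_dvd_le hd hX hg hb.1.1
        have hhR : (0 : ℝ) < h := by exact_mod_cast hh
        set H : ℝ := (h : ℝ) ^ (-(1 / d : ℝ)) with hH
        have hHsq : (h : ℝ) ^ (-(2 / d : ℝ)) = H ^ 2 := by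
          rw [hH, ← Real.rpow_natCast, ← Real.rpow_mul hhR.le]
          congr 1; push_cast; ring
        have h2 : (b : ℝ) ^ (-(1 / d : ℝ)) ≤ H := by
          refine Real.rpow_le_rpow_of_nonpos hhR (by exact_mod_cast hb.2) ?_
          rw [neg_nonpos]; positivity
        have hH0 : 0 ≤ H := by positivity
        have h3 : (((pairs X).filter fun p => (b : ℤ) ∣ powDiff d p).card : ℝ) ≤
            3 * X * (D * (3 * X * H + 1)) := h1.trans (by gcongr)
        calc _ ≤ (3 * X * (D * (3 * X * H + 1))) * (3 * X * (D * (3 * X * H + 1))) := by gcongr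
          _ = 9 * X ^ 2 * D ^ 2 * (3 * X * H + 1) ^ 2 := by ring
          _ ≤ 9 * X ^ 2 * D ^ 2 * (18 * X ^ 2 * H ^ 2 + 9 * X) := by
              gcongr
              nlinarith [sq_nonneg (3 * X * H - 1)]
          _ = _ := by rw [hHsq]; field_simp; ring
    _ = ((g.divisors.filter (h ≤ ·)).card : ℝ) * (81 * X ^ 4 * D ^ 2 *
        (2 * (h : ℝ) ^ (-(2 / d : ℝ)) + 1 / X)) := by rw [Finset.sum_const, nsmul_eq_mul]
    _ ≤ _ := by
        gcongr
        exact Finset.filter_subset _ _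

/-- Few quadruples have a vector that is parallel to a given one modulo `g` and at least as
divisible. -/
theorem card_quads_dvd_minor_le {d : ℕ} (hd : 0 < d) {X : ℝ} (hX : 1 ≤ X) {g : ℕ}
    (hg : g ≠ 0) (p : (ℤ × ℤ) × (ℤ × ℤ)) :
    (((quads X).filter fun q => gcdVec d g p ≤ gcdVec d g q ∧ (g : ℤ) ∣ minor d p q).card : ℝ) ≤
      162 * X ^ 4 * (g.divisors.card * (d ^ g.primeFactors.card : ℕ) ^ 2) *
        ((g : ℝ) ^ (-(2 / (3 * d) : ℝ)) + 1 / X) := by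
  set D : ℝ := ((d ^ g.primeFactors.card : ℕ) : ℝ) with hD
  have hX0 : 0 < X := by linarith
  have hD0 : 0 ≤ D := by positivity
  have hgR : (0 : ℝ) < g := by exact_mod_cast Nat.pos_of_ne_zero hg
  have hdR : (0 : ℝ) < d := by exact_mod_cast hd
  set h := gcdVec d g p with hh
  have hhg : h ∣ g := Nat.gcd_dvd_left _ _
  have hh0 : 0 < h := Nat.pos_of_dvd_of_pos hhg (Nat.pos_of_ne_zero hg)
  have hhR : (0 : ℝ) < h := by exact_mod_cast hh0
  have hτ : (1 : ℝ) ≤ g.divisors.card := by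
    exact_mod_cast Finset.card_pos.2 ⟨1, by simp [hg]⟩
  -- Large `h` makes all competing vectors divisible and saves `h ^ (-2/d)`; small `h` leaves a
  -- congruence modulo `g / h` and saves `(g / h) ^ (-1/d)`. The two agree at `h = g ^ (1/3)`, with
  -- value `g ^ (-2/(3d))`.
  rcases le_or_gt ((g : ℝ) ^ (1 / 3 : ℝ)) h with hbig | hsmall
  · calc _ ≤ (((quads X).filter fun q => h ≤ gcdVec d g q).card : ℝ) := by
          norm_cast
          exact Finset.card_le_card fun q hq => by
            rw [Finset.mem_filter] at hq ⊢; exact ⟨hq.1, hq.2.1⟩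
      _ ≤ _ := card_quads_gcdVec_ge_le hd hX hg hh0
      _ ≤ g.divisors.card * (81 * X ^ 4 * D ^ 2 *
            (2 * (g : ℝ) ^ (-(2 / (3 * d) : ℝ)) + 2 * (1 / X))) := by
          have h1 : (h : ℝ) ^ (-(2 / d : ℝ)) ≤ (g : ℝ) ^ (-(2 / (3 * d) : ℝ)) := by
            calc (h : ℝ) ^ (-(2 / d : ℝ)) ≤ ((g : ℝ) ^ (1 / 3 : ℝ)) ^ (-(2 / d : ℝ)) :=
                  Real.rpow_le_rpow_of_nonpos (by positivity) hbig (by rw [neg_nonpos]; positivity)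
              _ = _ := by rw [← Real.rpow_mul hgR.le]; congr 1; field_simp
          have h2 : 1 / X ≤ 2 * (1 / X) := by
            have : 0 < 1 / X := by positivity
            linarith
          gcongr
      _ = _ := by ring
  · have hf : g / h ∣ g := Nat.div_dvd_of_dvd hhg
    obtain ⟨α, hα⟩ : (h : ℤ) ∣ powDiff d p.1 :=
      (Int.natCast_dvd_natCast.2 (Nat.gcd_dvd_right g _)).trans (Int.gcd_dvd_left ..)
    obtain ⟨β, hβ⟩ : (h : ℤ) ∣ powDiff d p.2 :=
      (Int.natCast_dvd_natCast.2 (Nat.gcd_dvd_right g _)).trans (Int.gcd_dvd_right ..)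
    -- `h` is the whole common divisor with `g`, so nothing is left after dividing by it.
    have hco : Nat.gcd (g / h) (Int.gcd α β) = 1 := by
      have h1 : h = h * Nat.gcd (g / h) (Int.gcd α β) := by
        conv_lhs => rw [hh, gcdVec, hα, hβ, Int.gcd_mul_left]
        rw [Int.natAbs_natCast, ← Nat.gcd_mul_left, Nat.mul_div_cancel' hhg]
      exact Nat.eq_of_mul_eq_mul_left hh0 (by omega)
    have h1 := card_quads_linear_dvd_le hd hX hg hf α β hco
    have hgh : ((g / h : ℕ) : ℝ) = g / h := Nat.cast_div_charZero hhg
    have h2 : (((g / h : ℕ) : ℝ)) ^ (-(1 / d : ℝ)) ≤ (g : ℝ) ^ (-(2 / (3 * d) : ℝ)) := by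
      have h3 : (g : ℝ) ^ (2 / 3 : ℝ) ≤ ((g / h : ℕ) : ℝ) := by
        rw [hgh, le_div_iff₀ hhR]
        calc (g : ℝ) ^ (2 / 3 : ℝ) * h ≤ (g : ℝ) ^ (2 / 3 : ℝ) * (g : ℝ) ^ (1 / 3 : ℝ) := by
              gcongr
          _ = g := by rw [← Real.rpow_add hgR]; norm_num
      calc _ ≤ ((g : ℝ) ^ (2 / 3 : ℝ)) ^ (-(1 / d : ℝ)) :=
            Real.rpow_le_rpow_of_nonpos (by positivity) h3 (by rw [neg_nonpos]; positivity)
        _ = _ := by rw [← Real.rpow_mul hgR.le]; congr 1; field_simp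
    calc _ ≤ (((quads X).filter fun q =>
          ((g / h : ℕ) : ℤ) ∣ α * powDiff d q.2 - β * powDiff d q.1).card : ℝ) := by
          norm_cast
          refine Finset.card_le_card fun q hq => ?_
          rw [Finset.mem_filter] at hq ⊢
          refine ⟨hq.1, ?_⟩
          have h3 := hq.2.2
          rw [minor, hα, hβ] at h3
          refine (mul_dvd_mul_iff_left (a := (h : ℤ)) (by exact_mod_cast hh0.ne')).1 ?_
          have h4 : (h : ℤ) * ((g / h : ℕ) : ℤ) = g := by exact_mod_cast Nat.mul_div_cancel' hhg
          rw [h4]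
          rwa [show (h : ℤ) * (α * powDiff d q.2 - β * powDiff d q.1) =
            h * α * powDiff d q.2 - h * β * powDiff d q.1 by ring]
      _ ≤ _ := h1
      _ ≤ 81 * X ^ 4 * (2 * (g.divisors.card * D ^ 2)) *
            ((g : ℝ) ^ (-(2 / (3 * d) : ℝ)) + 1 / X) := by
          have : D ^ 2 ≤ 2 * (g.divisors.card * D ^ 2) := by nlinarith [sq_nonneg D]
          gcongr
      _ = _ := by ring

/-! ### Quadruples under size conditions. -/

theorem card_le_of_sub_le (S : Finset ℤ) {L : ℝ} (hL : 0 ≤ L)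
    (h : ∀ a ∈ S, ∀ b ∈ S, (a : ℝ) - b ≤ L) : (S.card : ℝ) ≤ L + 1 := by
  rcases S.eq_empty_or_nonempty with rfl | hS
  · simp; linarith
  have hle : S.min' hS ≤ S.max' hS := Finset.min'_le _ _ (S.max'_mem hS)
  have h1 : S ⊆ Finset.Icc (S.min' hS) (S.max' hS) := fun a ha =>
    Finset.mem_Icc.2 ⟨S.min'_le a ha, S.le_max' a ha⟩
  have h2 := Finset.card_le_card h1
  have h3 : ((Finset.Icc (S.min' hS) (S.max' hS)).card : ℤ) = S.max' hS - S.min' hS + 1 := by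
    rw [Int.card_Icc]; omega
  have h4 : ((Finset.Icc (S.min' hS) (S.max' hS)).card : ℝ) = S.max' hS - S.min' hS + 1 := by
    exact_mod_cast h3
  have h5 : (S.card : ℝ) ≤ ((Finset.Icc (S.min' hS) (S.max' hS)).card : ℝ) := by exact_mod_cast h2
  rw [h4] at h5
  linarith [h _ (S.max'_mem hS) _ (S.min'_mem hS)]

/-- An elementary mean value bound: powers of numbers at least `Y` are spaced out by `Y ^ n`. The
lower bound `X / 2 ≤ |x|` in the annulus is there to be used as `Y`. -/
theorem sub_mul_pow_le {n : ℕ} {a b Y : ℝ} (hY : 0 ≤ Y) (hb : Y ≤ b) (hab : b ≤ a) :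
    (a - b) * Y ^ n ≤ a ^ (n + 1) - b ^ (n + 1) := by
  have h1 : Y ^ n ≤ a ^ n := pow_le_pow_left₀ hY (hb.trans hab) n
  have h2 : b ^ n ≤ a ^ n := pow_le_pow_left₀ (hY.trans hb) hab n
  rw [pow_succ, pow_succ]
  nlinarith [mul_le_mul_of_nonneg_left h1 (sub_nonneg.2 hab),
    mul_le_mul_of_nonneg_right h2 (hY.trans hb)]

/-- Few integers of the annulus have their `d`-th power in a short interval. -/
theorem card_annulus_pow_near_le {d : ℕ} (hd : 0 < d) {X : ℝ} (hX : 1 ≤ X) (c : ℝ) {R : ℝ}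
    (hR : 0 ≤ R) : (((annulus X).filter fun w : ℤ => |(w : ℝ) ^ d - c| ≤ R).card : ℝ) ≤
      2 * (2 * R / (X / 2) ^ (d - 1) + 1) := by
  classical
  obtain ⟨n, rfl⟩ : ∃ n, d = n + 1 := ⟨d - 1, by omega⟩
  have hY : 0 < (X / 2) ^ n := by positivity
  set S := (annulus X).filter fun w : ℤ => |(w : ℝ) ^ (n + 1) - c| ≤ R
  -- The reals `s, t` stand for `a, b` or for `-a, -b`, so that one argument covers both signs; the
  -- two signs account for the outer factor `2`.
  have key : ∀ a b : ℤ, a ∈ S → b ∈ S → ∀ s t : ℝ, |s| = |(a : ℝ)| → |t| = |(b : ℝ)| → 0 ≤ s →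
      0 ≤ t → |s ^ (n + 1) - t ^ (n + 1)| = |(a : ℝ) ^ (n + 1) - b ^ (n + 1)| →
      s - t ≤ 2 * R / (X / 2) ^ n := by
    intro a b ha hb s t hs ht hs0 ht0 hst
    rw [Finset.mem_filter, mem_annulus] at ha hb
    have h1 : |s ^ (n + 1) - t ^ (n + 1)| ≤ 2 * R := by
      rw [hst]
      calc _ ≤ |(a : ℝ) ^ (n + 1) - c| + |c - (b : ℝ) ^ (n + 1)| := abs_sub_le _ _ _
        _ ≤ R + R := by rw [abs_sub_comm c]; exact add_le_add ha.2 hb.2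
        _ = _ := by ring
    rcases le_total s t with h | h
    · have : 0 ≤ 2 * R / (X / 2) ^ n := by positivity
      linarith
    rw [le_div_iff₀ hY]
    have h2 : X / 2 ≤ t := by rw [← abs_of_nonneg ht0, ht]; exact hb.1.1
    exact (sub_mul_pow_le (by linarith) h2 h).trans ((le_abs_self _).trans h1)
  have hpos : ((S.filter (0 ≤ ·)).card : ℝ) ≤ 2 * R / (X / 2) ^ n + 1 := by
    refine card_le_of_sub_le _ (by positivity) fun a ha b hb => ?_
    rw [Finset.mem_filter] at ha hb
    exact key a b ha.1 hb.1 a b rfl rfl (by exact_mod_cast ha.2) (by exact_mod_cast hb.2) rfl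
  have hneg : ((S.filter (¬ 0 ≤ ·)).card : ℝ) ≤ 2 * R / (X / 2) ^ n + 1 := by
    refine card_le_of_sub_le _ (by positivity) fun a ha b hb => ?_
    rw [Finset.mem_filter, not_le] at ha hb
    have h := key b a hb.1 ha.1 (-b) (-a) (abs_neg _) (abs_neg _)
      (by have : (b : ℝ) < 0 := by exact_mod_cast hb.2
          linarith)
      (by have : (a : ℝ) < 0 := by exact_mod_cast ha.2
          linarith)
      (by rw [neg_pow, neg_pow (a : ℝ), ← mul_sub, abs_mul, abs_pow]; simp)
    linarith
  have hsum : S.card = (S.filter (0 ≤ ·)).card + (S.filter (¬ 0 ≤ ·)).card :=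
    (Finset.card_filter_add_card_filter_not _).symm
  rw [hsum, Nat.add_sub_cancel]
  push_cast
  linarith

/-- If `|x| ≠ |z|`, these differ by at least `1` and the spacing of powers applies. Otherwise `x =
-z` with `d` odd, and the value is `-2 z ^ d`. -/
theorem le_abs_powDiff {d : ℕ} (hd : 0 < d) {X : ℝ} (hX : 1 ≤ X) {p : ℤ × ℤ} (hp : p ∈ pairs X)
    (h0 : powDiff d p ≠ 0) : (X / 2) ^ (d - 1) ≤ |(powDiff d p : ℝ)| := by
  obtain ⟨n, rfl⟩ : ∃ n, d = n + 1 := ⟨d - 1, by omega⟩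
  rw [Nat.add_sub_cancel]
  obtain ⟨x, z⟩ := p
  rw [pairs, Finset.mem_product, mem_annulus, mem_annulus] at hp
  obtain ⟨⟨hx, -⟩, ⟨hz, -⟩⟩ := hp
  simp only [powDiff, ne_eq] at *
  have hY : 0 ≤ (X / 2) ^ n := by positivity
  have hxz : |(|(x : ℝ)| ^ (n + 1) - |(z : ℝ)| ^ (n + 1))| ≤ |((x ^ (n + 1) - z ^ (n + 1) : ℤ) : ℝ)| := by
    push_cast
    rw [← abs_pow, ← abs_pow]
    exact abs_abs_sub_abs_le _ _
  by_cases hne : |x| = |z|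
  · rcases abs_eq_abs.1 hne with rfl | rfl
    · simp at h0
    · rcases Nat.even_or_odd (n + 1) with he | ho
      · exfalso; apply h0; rw [he.neg_pow]; ring
      · rw [ho.neg_pow]
        have hz1 : (1 : ℝ) ≤ |(z : ℝ)| := by
          have : z ≠ 0 := by
            rintro rfl
            simp at hz; linarith
          exact_mod_cast Int.one_le_abs this
        push_cast
        rw [show -(z : ℝ) ^ (n + 1) - z ^ (n + 1) = -(2 * z ^ (n + 1)) by ring, abs_neg, abs_mul,
          abs_pow, abs_two, pow_succ]
        have h1 : (X / 2) ^ n ≤ |(z : ℝ)| ^ n := pow_le_pow_left₀ (by linarith) hz n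
        nlinarith [mul_le_mul_of_nonneg_left hz1 (hY.trans h1)]
  · refine le_trans ?_ hxz
    rcases lt_or_gt_of_ne hne with h | h
    · have h1 : |(x : ℝ)| + 1 ≤ |(z : ℝ)| := by exact_mod_cast h
      have := sub_mul_pow_le (n := n) (by linarith : 0 ≤ X / 2) hx (by linarith : |(x : ℝ)| ≤ |(z : ℝ)|)
      rw [abs_sub_comm]
      refine le_trans ?_ (le_abs_self _)
      nlinarith
    · have h1 : |(z : ℝ)| + 1 ≤ |(x : ℝ)| := by exact_mod_cast h
      have := sub_mul_pow_le (n := n) (by linarith : 0 ≤ X / 2) hz (by linarith : |(z : ℝ)| ≤ |(x : ℝ)|)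
      refine le_trans ?_ (le_abs_self _)
      nlinarith

theorem abs_powDiff_le {d : ℕ} {X : ℝ} {p : ℤ × ℤ} (hp : p ∈ pairs X) :
    |(powDiff d p : ℝ)| ≤ 2 * X ^ d := by
  obtain ⟨x, z⟩ := p
  rw [pairs, Finset.mem_product, mem_annulus, mem_annulus] at hp
  simp only [powDiff] at *
  push_cast
  calc _ ≤ |(x : ℝ) ^ d| + |(z : ℝ) ^ d| := abs_sub _ _
    _ ≤ X ^ d + X ^ d := by
        rw [abs_pow, abs_pow]
        exact add_le_add (pow_le_pow_left₀ (abs_nonneg _) hp.1.2 d)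
          (pow_le_pow_left₀ (abs_nonneg _) hp.2.2 d)
    _ = _ := by ring

/-- The sup norm of the vector of a quadruple. -/
noncomputable def vecNorm (d : ℕ) (q : (ℤ × ℤ) × (ℤ × ℤ)) : ℝ :=
  max |(powDiff d q.1 : ℝ)| |(powDiff d q.2 : ℝ)|

theorem card_pairs_near_le {d : ℕ} (hd : 0 < d) {X : ℝ} (hX : 1 ≤ X) (c : ℝ) {R : ℝ}
    (hR : 0 ≤ R) : (((pairs X).filter fun p => |(powDiff d p : ℝ) - c| ≤ R).card : ℝ) ≤
      3 * X * (2 * (2 * R / (X / 2) ^ (d - 1) + 1)) := by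
  have hX0 : 0 < X := by linarith
  refine card_filter_product_le _ _ (fun x z : ℤ => |(powDiff d (x, z) : ℝ) - c| ≤ R)
    (by positivity) (card_annulus_le hX) fun x _ => ?_
  refine le_trans ?_ (card_annulus_pow_near_le hd hX ((x : ℝ) ^ d - c) hR)
  refine Nat.cast_le.2 (Finset.card_le_card (Finset.monotone_filter_right _ fun z _ hz => ?_))
  have hz' : |(powDiff d (x, z) : ℝ) - c| ≤ R := hz
  simp only [powDiff] at hz'
  push_cast at hz'
  rw [abs_sub_comm, show (x : ℝ) ^ d - c - z ^ d = x ^ d - z ^ d - c by ring]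
  exact hz'

theorem card_quads_vecNorm_le {d : ℕ} (hd : 0 < d) {X : ℝ} (hX : 1 ≤ X) {R : ℝ} (hR : 0 ≤ R) :
    (((quads X).filter fun q => vecNorm d q ≤ R).card : ℝ) ≤
      54 * X ^ 3 * (2 * R / (X / 2) ^ (d - 1) + 1) := by
  have hX0 : 0 < X := by linarith
  have h1 := card_pairs_near_le hd hX 0 hR
  have h2 := card_pairs_le hX
  calc _ ≤ ((((pairs X).filter fun p => |(powDiff d p : ℝ) - 0| ≤ R) ×ˢ pairs X).card : ℝ) := by
        refine Nat.cast_le.2 (Finset.card_le_card fun q hq => ?_)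
        rw [Finset.mem_filter, quads, Finset.mem_product] at hq
        rw [Finset.mem_product, Finset.mem_filter, sub_zero]
        exact ⟨⟨hq.1.1, (le_max_left _ _).trans hq.2⟩, hq.1.2⟩
    _ ≤ (3 * X * (2 * (2 * R / (X / 2) ^ (d - 1) + 1))) * (9 * X ^ 2) := by
        rw [Finset.card_product]; push_cast; gcongr
    _ = _ := by ring

/-- The condition is a strip along the line through the vector of `p`. After one pair of `q` is
chosen freely, dividing by the larger component of `p` confines the power difference of the other
pair to within `T / vecNorm d p` of a point. -/
theorem card_quads_minor_le {d : ℕ} (hd : 0 < d) {X : ℝ} (hX : 1 ≤ X) (p : (ℤ × ℤ) × (ℤ × ℤ))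
    (hp : 0 < vecNorm d p) {T : ℝ} (hT : 0 ≤ T) :
    (((quads X).filter fun q => |(minor d p q : ℝ)| ≤ T).card : ℝ) ≤
      54 * X ^ 3 * (2 * T / (vecNorm d p * (X / 2) ^ (d - 1)) + 1) := by
  have hX0 : 0 < X := by linarith
  have key : ∀ a b c : ℝ, |a| = vecNorm d p → |a * b - c| ≤ T → |b - c / a| ≤ T / vecNorm d p := by
    intro a b c ha h
    rw [le_div_iff₀ hp, ← ha, ← abs_mul, mul_comm]
    have ha0 : a ≠ 0 := by rintro rfl; rw [abs_zero] at ha; linarith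
    rwa [mul_sub, mul_div_cancel₀ _ ha0]
  have e : 54 * X ^ 3 * (2 * T / (vecNorm d p * (X / 2) ^ (d - 1)) + 1) =
      9 * X ^ 2 * (3 * X * (2 * (2 * (T / vecNorm d p) / (X / 2) ^ (d - 1) + 1))) := by
    field_simp; ring
  rw [e]
  rcases le_total |(powDiff d p.2 : ℝ)| |(powDiff d p.1 : ℝ)| with h | h
  · have hn : |(powDiff d p.1 : ℝ)| = vecNorm d p := (max_eq_left h).symm
    refine card_filter_product_le _ _ (fun a b => |(minor d p (a, b) : ℝ)| ≤ T) (by positivity)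
      (card_pairs_le hX) fun a _ => ?_
    refine le_trans ?_ (card_pairs_near_le hd hX
      ((powDiff d p.2 * powDiff d a : ℝ) / powDiff d p.1) (R := T / vecNorm d p) (by positivity))
    refine Nat.cast_le.2 (Finset.card_le_card (Finset.monotone_filter_right _ fun b _ hb => ?_))
    refine key _ _ _ hn ?_
    simpa [minor] using hb
  · have hn : |(powDiff d p.2 : ℝ)| = vecNorm d p := (max_eq_right h).symm
    refine card_filter_product_le' _ _ (fun a b => |(minor d p (a, b) : ℝ)| ≤ T) (by positivity)
      (card_pairs_le hX) fun b _ => ?_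
    refine le_trans ?_ (card_pairs_near_le hd hX
      ((powDiff d p.1 * powDiff d b : ℝ) / powDiff d p.2) (R := T / vecNorm d p) (by positivity))
    refine Nat.cast_le.2 (Finset.card_le_card (Finset.monotone_filter_right _ fun a _ ha => ?_))
    refine key _ _ _ hn ?_
    rw [abs_sub_comm]
    simpa [minor] using ha

/-! ### Representations by differences of `d`-th powers. -/

/-- A nonzero integer has few representations as a difference of two `d`-th powers. -/
theorem card_pairs_powDiff_eq_le {d : ℕ} (hd : 2 ≤ d) (X : ℝ) {v : ℤ} (hv : v ≠ 0) :
    ((pairs X).filter fun p => powDiff d p = v).card ≤ 2 * d * v.natAbs.divisors.card := by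
  classical
  set S := (pairs X).filter fun p => powDiff d p = v
  -- The difference `t = x - z` divides `v`, leaving `2 τ(|v|)` values with signs; for each of them
  -- `x` is a root of a polynomial of degree at most `d`.
  have himg : (S.image fun p => p.1 - p.2) ⊆
      v.natAbs.divisors.image (fun n : ℕ => (n : ℤ)) ∪ v.natAbs.divisors.image (fun n : ℕ => -(n : ℤ)) := by
    intro t ht
    obtain ⟨p, hp, rfl⟩ := Finset.mem_image.1 ht
    have hp2 := (Finset.mem_filter.1 hp).2
    have hdvd : p.1 - p.2 ∣ v := by rw [← hp2]; exact sub_dvd_pow_sub_pow _ _ _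
    have h1 : (p.1 - p.2).natAbs ∈ v.natAbs.divisors :=
      Nat.mem_divisors.2 ⟨Int.natAbs_dvd_natAbs.2 hdvd, Int.natAbs_ne_zero.2 hv⟩
    rw [Finset.mem_union, Finset.mem_image, Finset.mem_image]
    rcases Int.natAbs_eq (p.1 - p.2) with h | h
    · left; exact ⟨_, h1, h.symm⟩
    · right; exact ⟨_, h1, h.symm⟩
  have hcard : (S.image fun p => p.1 - p.2).card ≤ 2 * v.natAbs.divisors.card := by
    refine (Finset.card_le_card himg).trans ((Finset.card_union_le _ _).trans ?_)
    have h1 := Finset.card_image_le (s := v.natAbs.divisors) (f := fun n : ℕ => (n : ℤ))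
    have h2 := Finset.card_image_le (s := v.natAbs.divisors) (f := fun n : ℕ => -(n : ℤ))
    omega
  have hfib : ∀ t ∈ S.image (fun p => p.1 - p.2), (S.filter fun p => p.1 - p.2 = t).card ≤ d := by
    intro t ht
    have ht0 : t ≠ 0 := by
      rintro rfl
      obtain ⟨p, hp, h⟩ := Finset.mem_image.1 ht
      have h' : p.1 = p.2 := sub_eq_zero.1 h
      exact hv (by rw [← (Finset.mem_filter.1 hp).2, powDiff, h', sub_self])
    set P : Polynomial ℤ := Polynomial.X ^ d - (Polynomial.X - Polynomial.C t) ^ d - Polynomial.C v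
      with hP
    have heval : ∀ y : ℤ, P.eval y = y ^ d - (y - t) ^ d - v := by intro y; simp [hP]
    -- Vanishing at both `t` and `2t` would give `(2 ^ d - 2) t ^ d = 0`.
    have hP0 : P ≠ 0 := by
      intro h0
      have e1 := heval t
      have e2 := heval (2 * t)
      rw [h0, Polynomial.eval_zero] at e1 e2
      rw [sub_self, zero_pow (by omega)] at e1
      rw [show 2 * t - t = t by ring, mul_pow] at e2
      have e3 : ((2 : ℤ) ^ d - 2) * t ^ d = 0 := by linarith
      have e4 : (4 : ℤ) ≤ 2 ^ d := by
        calc (4 : ℤ) = 2 ^ 2 := by norm_num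
          _ ≤ _ := pow_le_pow_right₀ (by norm_num) hd
      rcases mul_eq_zero.1 e3 with h | h
      · omega
      · exact ht0 (pow_eq_zero_iff (by omega) |>.1 h)
    have hdeg : P.natDegree ≤ d := by
      rw [hP]
      refine (Polynomial.natDegree_sub_le _ _).trans (max_le ?_ (by simp))
      refine (Polynomial.natDegree_sub_le _ _).trans (max_le (by simp) ?_)
      refine Polynomial.natDegree_pow_le.trans ?_
      rw [Polynomial.natDegree_X_sub_C, mul_one]
    calc (S.filter fun p => p.1 - p.2 = t).card ≤ P.roots.toFinset.card := by
          refine Finset.card_le_card_of_injOn Prod.fst ?_ ?_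
          · intro p hp
            simp only [Finset.coe_filter, Set.mem_ofPred_eq] at hp
            have hp2 := (Finset.mem_filter.1 hp.1).2
            rw [Finset.mem_coe, Multiset.mem_toFinset, Polynomial.mem_roots hP0,
              Polynomial.IsRoot.def, heval, ← hp.2, sub_sub_cancel, ← hp2, powDiff, sub_self]
          · intro p hp p' hp' h
            simp only [Finset.coe_filter, Set.mem_ofPred_eq] at hp hp'
            refine Prod.ext h ?_
            have := hp.2.trans hp'.2.symm
            omega
      _ ≤ Multiset.card P.roots := Multiset.toFinset_card_le _
      _ ≤ _ := (Polynomial.card_roots' P).trans hdeg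
  calc S.card ≤ d * (S.image fun p => p.1 - p.2).card := Finset.card_le_mul_card_image _ _ hfib
    _ ≤ d * (2 * v.natAbs.divisors.card) := Nat.mul_le_mul_left _ hcard
    _ = _ := by ring

theorem card_pairs_powDiff_zero_le {d : ℕ} (hd : 0 < d) {X : ℝ} (hX : 1 ≤ X) :
    (((pairs X).filter fun p => powDiff d p = 0).card : ℝ) ≤ 6 * X := by
  have h := card_pairs_near_le hd hX 0 (R := 0) le_rfl
  calc _ ≤ _ := by
        refine Nat.cast_le.2 (Finset.card_le_card (Finset.monotone_filter_right _ fun p _ hp => ?_))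
        have hp' : powDiff d p = 0 := hp
        rw [hp']; simp
    _ ≤ _ := h
    _ = _ := by ring

/-! ### Relations between plane vectors and the index of their lattice. -/

theorem index_span_rows {n : ℕ} (v : Fin n → Fin n → ℤ) (hv : (Matrix.of v).det ≠ 0) :
    (Submodule.span ℤ (Set.range v)).toAddSubgroup.index = (Matrix.of v).det.natAbs := by
  have hli : LinearIndependent ℤ v := Matrix.linearIndependent_rows_of_det_ne_zero hv
  have h := Submodule.natAbs_det_basis_change (Pi.basisFun ℤ (Fin n)) _ (Module.Basis.span hli)
  have h2 : (Subtype.val ∘ (Module.Basis.span hli) : Fin n → Fin n → ℤ) = v :=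
    funext fun i => congrArg Subtype.val (Module.Basis.span_apply hli i)
  rw [h2, Pi.basisFun_det_apply] at h
  exact h.symm

/-- Integer vectors with coordinates bounded by `A`. -/
noncomputable def coeffBox (ι : Type*) [Fintype ι] [DecidableEq ι] (A : ℝ) : Finset (ι → ℤ) :=
  Fintype.piFinset fun _ => Finset.Icc (-⌊A⌋) ⌊A⌋

theorem card_relations_le_of_ne_zero {ι : Type*} [Fintype ι] [DecidableEq ι]
    (u : ι → ℤ) (i : ι) (hi : u i ≠ 0) {A : ℝ} (hA : 1 ≤ A) :
    (((coeffBox ι A).filter fun a => ∑ k, a k * u k = 0).card : ℝ) ≤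
      (3 * A) ^ (Fintype.card ι - 1) := by
  have h : ((coeffBox ι A).filter fun a => ∑ k, a k * u k = 0).card ≤
      (coeffBox {k // k ≠ i} A).card := by
    refine Finset.card_le_card_of_injOn (fun a k => a k) ?_ ?_
    · intro a ha
      simp only [Finset.coe_filter, Set.mem_ofPred_eq, coeffBox, Fintype.mem_piFinset,
        Finset.mem_coe] at ha ⊢
      exact fun k => ha.1 k
    · intro a ha b hb hab
      simp only [Finset.coe_filter, Set.mem_ofPred_eq] at ha hb
      have hk : ∀ k, k ≠ i → a k = b k := fun k hk => congrFun hab ⟨k, hk⟩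
      have h1 : ∑ k, (a k - b k) * u k = 0 := by
        simp_rw [sub_mul, Finset.sum_sub_distrib]
        rw [ha.2, hb.2, sub_self]
      rw [Finset.sum_eq_single i (fun k _ hki => by rw [hk k hki, sub_self, zero_mul])
        (fun h => absurd (Finset.mem_univ i) h)] at h1
      funext k
      by_cases hki : k = i
      · subst hki
        exact sub_eq_zero.1 ((mul_eq_zero.1 h1).resolve_right hi)
      · exact hk k hki
  have h2 : ((coeffBox {k // k ≠ i} A).card : ℝ) ≤ (3 * A) ^ (Fintype.card ι - 1) := by
    rw [coeffBox, Fintype.card_piFinset, Finset.prod_const, Finset.card_univ]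
    have h3 : Fintype.card {k // k ≠ i} = Fintype.card ι - 1 := by
      rw [Fintype.card_subtype_compl, Fintype.card_subtype_eq]
    rw [h3]
    push_cast
    exact pow_le_pow_left₀ (by positivity) (card_Icc_floor_le hA) _
  exact (Nat.cast_le.2 h).trans h2

/-- Counting integer relations between integer vectors that span a sublattice of `ℤ²` of
index `g`. -/
theorem exists_index_card_relations_le {ι : Type*} [Fintype ι] [DecidableEq ι]
    (u v : ι → ℤ) (i j : ι)
    (hij : u i * v j - v i * u j ≠ 0) :
    ∃ g : ℕ, g ≠ 0 ∧ (∀ k l, (g : ℤ) ∣ u k * v l - v k * u l) ∧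
      ∀ A : ℝ, 1 ≤ A → |((u i * v j - v i * u j : ℤ) : ℝ)| ≤ 8 * A →
        (((coeffBox ι A).filter fun a => ∑ k, a k * u k = 0 ∧ ∑ k, a k * v k = 0).card : ℝ) *
          |((u i * v j - v i * u j : ℤ) : ℝ)| ≤ g * (11 * A) ^ (Fintype.card ι - 2) := by
  classical
  set c : ι → Fin 2 → ℤ := fun k => ![u k, v k] with hc
  set Λ : AddSubgroup (Fin 2 → ℤ) := (Submodule.span ℤ (Set.range c)).toAddSubgroup with hΛ
  set L : ι → ι → AddSubgroup (Fin 2 → ℤ) := fun k l =>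
    (Submodule.span ℤ (Set.range ![c k, c l])).toAddSubgroup
    with hL
  have hrow : ∀ k l, Set.range ![c k, c l] = {c k, c l} := fun k l => by
    rw [Matrix.range_cons_cons_empty]
  have hLΛ : ∀ k l, L k l ≤ Λ := by
    intro k l
    refine Submodule.toAddSubgroup_mono (Submodule.span_mono ?_)
    rw [hrow]
    rintro x (rfl | rfl)
    · exact ⟨k, rfl⟩
    · exact ⟨l, rfl⟩
  have hindex : ∀ k l, u k * v l - v k * u l ≠ 0 →
      (L k l).index = (u k * v l - v k * u l).natAbs := by
    intro k l h
    have hdet : (Matrix.of ![c k, c l]).det = u k * v l - v k * u l := by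
      rw [Matrix.det_fin_two]; simp [hc]
    rw [← hdet]
    exact index_span_rows _ (by rwa [hdet])
  set Δ : ℤ := u i * v j - v i * u j with hΔ
  have hn := AddSubgroup.relIndex_mul_index (hLΛ i j)
  rw [hindex i j hij] at hn
  have hΔ0 : Δ.natAbs ≠ 0 := Int.natAbs_ne_zero.2 hij
  have hg0 : Λ.index ≠ 0 := by
    intro h; rw [h, mul_zero] at hn; exact hΔ0 hn.symm
  have hn0 : (L i j).relIndex Λ ≠ 0 := by
    intro h; rw [h, zero_mul] at hn; exact hΔ0 hn.symm
  refine ⟨Λ.index, hg0, fun k l => ?_, fun A hA hΔA => ?_⟩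
  · by_cases h : u k * v l - v k * u l = 0
    · rw [h]; exact dvd_zero _
    · rw [← Int.dvd_natAbs, Int.natCast_dvd_natCast, ← hindex k l h]
      exact AddSubgroup.index_dvd_of_le (hLΛ k l)
  have hci : c i ∈ L i j := Submodule.subset_span (by rw [hrow]; simp)
  have hcj : c j ∈ L i j := Submodule.subset_span (by rw [hrow]; simp)
  have hne : i ≠ j := by rintro rfl; apply hij; rw [hΔ]; ring
  have hmem : ∀ a : ι → ℤ, ∑ k, a k • c k ∈ Λ := fun a =>
    Submodule.sum_mem _ fun k _ => Submodule.smul_mem _ _ (Submodule.subset_span ⟨k, rfl⟩)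
  -- `|Δ|` is the index of `L i j`, so it annihilates the quotient. Hence coefficients matter only
  -- modulo `Δ`, and each class of `Λ` modulo `L i j` has a representative `r` with coefficients in
  -- `[0, |Δ|]`.
  have hΔmem : ∀ x : Fin 2 → ℤ, Δ • x ∈ L i j := by
    intro x
    have h1 : Δ.natAbs • x ∈ L i j := by
      rw [← hindex i j hij]; exact AddSubgroup.nsmul_index_mem _ x
    rcases Int.natAbs_eq Δ with h | h
    · rw [h, natCast_zsmul]; exact h1
    · rw [h, neg_smul, natCast_zsmul]; exact neg_mem h1
  let Q := Λ ⧸ (L i j).addSubgroupOf Λ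
  have hQ : Nat.card Q = (L i j).relIndex Λ := rfl
  have : Finite Q := Nat.finite_of_card_ne_zero (by rw [hQ]; exact hn0)
  have := Fintype.ofFinite Q
  have hrep : ∀ κ : Q, ∃ r : ι → ℤ, (∀ k, 0 ≤ r k ∧ r k ≤ |Δ|) ∧
      ((⟨∑ k, r k • c k, hmem r⟩ : Λ) : Q) = κ := by
    intro κ
    obtain ⟨⟨x, hx⟩, rfl⟩ := QuotientAddGroup.mk_surjective κ
    obtain ⟨a, rfl⟩ := (Submodule.mem_span_range_iff_exists_fun ℤ).1 hx
    refine ⟨fun k => if k = i ∨ k = j then 0 else a k % Δ, fun k => ?_, ?_⟩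
    · dsimp only
      split_ifs
      · exact ⟨le_rfl, abs_nonneg _⟩
      · exact ⟨Int.emod_nonneg _ hij, (Int.emod_lt_abs _ hij).le⟩
    · rw [QuotientAddGroup.eq, AddSubgroup.mem_addSubgroupOf]
      show -(∑ k, (if k = i ∨ k = j then 0 else a k % Δ) • c k) + ∑ k, a k • c k ∈ L i j
      rw [neg_add_eq_sub, ← Finset.sum_sub_distrib]
      refine AddSubgroup.sum_mem _ fun k _ => ?_
      rw [← sub_smul]
      split_ifs with h
      · rcases h with rfl | rfl
        · exact AddSubgroup.zsmul_mem _ hci _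
        · exact AddSubgroup.zsmul_mem _ hcj _
      · have : a k - a k % Δ = Δ * (a k / Δ) := by
          have := Int.emod_add_mul_ediv (a k) Δ; linarith
        rw [this, mul_smul]
        exact hΔmem _
  choose r hrb hrκ using hrep
  set S := (coeffBox ι A).filter fun a => ∑ k, a k * u k = 0 ∧ ∑ k, a k * v k = 0 with hS
  have hSc : ∀ a ∈ S, ∑ k, a k • c k = 0 := by
    intro a ha
    have ha' := (Finset.mem_filter.1 ha).2
    funext t
    fin_cases t
    · simpa [hc, Finset.sum_apply] using ha'.1
    · simpa [hc, Finset.sum_apply] using ha'.2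
  have hsplit : ∀ a : ι → ℤ, (∀ k, k ≠ i → k ≠ j → a k = 0) → ∑ k, a k • c k = a i • c i + a j • c j := by
    intro a ha
    exact Fintype.sum_eq_add i j hne fun k hk => by rw [ha k hk.1 hk.2, zero_smul]
  -- Packing: the translates of the set of relations by the representatives `r κ` stay disjoint even
  -- when coordinates `i, j` are forgotten. If two agree off `i, j`, the representatives differ by
  -- an element of `L i j`, so `κ = μ`; the relations then agree because `c i, c j` are independent.
  -- There are `|Δ| / g` translates.
  have hcard : S.card * Fintype.card Q ≤
      (Fintype.piFinset fun _ : {k // k ≠ i ∧ k ≠ j} =>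
        Finset.Icc (-⌊A⌋) (⌊A⌋ + |Δ|)).card := by
    rw [← Finset.card_univ, ← Finset.card_product]
    refine Finset.card_le_card_of_injOn (fun p k => p.1 k + r p.2 k) ?_ ?_
    · intro p hp
      have hp1 := (Finset.mem_filter.1 (Finset.mem_product.1 hp).1).1
      rw [coeffBox, Fintype.mem_piFinset] at hp1
      rw [Finset.mem_coe, Fintype.mem_piFinset]
      intro k
      have h1 := Finset.mem_Icc.1 (hp1 k)
      have h2 := hrb p.2 k
      rw [Finset.mem_Icc]
      constructor <;> linarith
    · rintro ⟨a, κ⟩ hp ⟨b, μ⟩ hp' heq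
      have ha := (Finset.mem_product.1 hp).1
      have hb := (Finset.mem_product.1 hp').1
      dsimp only at ha hb
      have hk : ∀ k, k ≠ i → k ≠ j → a k + r κ k = b k + r μ k := fun k h1 h2 =>
        congrFun heq ⟨k, h1, h2⟩
      have hκμ : κ = μ := by
        rw [← hrκ κ, ← hrκ μ, QuotientAddGroup.eq, AddSubgroup.mem_addSubgroupOf]
        show -(∑ k, r κ k • c k) + ∑ k, r μ k • c k ∈ L i j
        have h1 := hsplit (fun k => (b k + r μ k) - (a k + r κ k)) fun k h1 h2 => by
          rw [hk k h1 h2, sub_self]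
        simp only [sub_smul, add_smul, Finset.sum_sub_distrib, Finset.sum_add_distrib,
          hSc a ha, hSc b hb, zero_add] at h1
        rw [neg_add_eq_sub, h1]
        refine AddSubgroup.add_mem _ ?_ ?_
        · rw [← add_smul, ← add_smul, ← sub_smul]; exact AddSubgroup.zsmul_mem _ hci _
        · rw [← add_smul, ← add_smul, ← sub_smul]; exact AddSubgroup.zsmul_mem _ hcj _
      subst hκμ
      have hk' : ∀ k, k ≠ i → k ≠ j → a k = b k := fun k h1 h2 => by
        have := hk k h1 h2; omega
      have h0 : ∑ k, (a k - b k) • c k = 0 := by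
        simp only [sub_smul, Finset.sum_sub_distrib, hSc a ha, hSc b hb, sub_self]
      rw [hsplit (fun k => a k - b k) fun k h1 h2 => by rw [hk' k h1 h2, sub_self]] at h0
      have e1 : (a i - b i) * u i + (a j - b j) * u j = 0 := by
        simpa [hc] using congrFun h0 0
      have e2 : (a i - b i) * v i + (a j - b j) * v j = 0 := by
        simpa [hc] using congrFun h0 1
      have e3 : (a i - b i) * Δ = 0 := by rw [hΔ]; linear_combination v j * e1 - u j * e2
      have e4 : (a j - b j) * Δ = 0 := by rw [hΔ]; linear_combination u i * e2 - v i * e1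
      have : a = b := by
        funext k
        by_cases h1 : k = i
        · rw [h1]; exact sub_eq_zero.1 ((mul_eq_zero.1 e3).resolve_right hij)
        by_cases h2 : k = j
        · rw [h2]; exact sub_eq_zero.1 ((mul_eq_zero.1 e4).resolve_right hij)
        exact hk' k h1 h2
      rw [this]
  have hbox : ((Fintype.piFinset fun _ : {k // k ≠ i ∧ k ≠ j} =>
        Finset.Icc (-⌊A⌋) (⌊A⌋ + |Δ|)).card : ℝ) ≤ (11 * A) ^ (Fintype.card ι - 2) := by
    rw [Fintype.card_piFinset, Finset.prod_const, Finset.card_univ]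
    have h3 : Fintype.card {k // k ≠ i ∧ k ≠ j} = Fintype.card ι - 2 := by
      rw [Fintype.card_subtype, ← Finset.card_univ]
      have : (Finset.univ.filter fun k => k ≠ i ∧ k ≠ j) = (Finset.univ.erase i).erase j := by
        ext k; simp [and_comm]
      rw [this, Finset.card_erase_of_mem (by simp [hne.symm]), Finset.card_erase_of_mem (by simp)]
      omega
    rw [h3]
    push_cast
    refine pow_le_pow_left₀ (by positivity) ?_ _
    have h0 : 0 ≤ ⌊A⌋ := Int.floor_nonneg.2 (by linarith)
    have h4 : ((Finset.Icc (-⌊A⌋) (⌊A⌋ + |Δ|)).card : ℤ) = 2 * ⌊A⌋ + |Δ| + 1 := by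
      have := abs_nonneg Δ
      rw [Int.card_Icc]; omega
    have h5 : ((Finset.Icc (-⌊A⌋) (⌊A⌋ + |Δ|)).card : ℝ) = 2 * ⌊A⌋ + |(Δ : ℝ)| + 1 := by
      have := congrArg (fun z : ℤ => (z : ℝ)) h4
      push_cast at this; exact this
    rw [h5]
    -- A side has at most `2A + |Δ| + 1 ≤ 11A` integers, by `|Δ| ≤ 8A` and `1 ≤ A`.
    linarith [Int.floor_le A]
  have hQn : Fintype.card Q = (L i j).relIndex Λ := by rw [← hQ, Nat.card_eq_fintype_card]
  have hΔR : |(Δ : ℝ)| = (Fintype.card Q : ℝ) * Λ.index := by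
    rw [hQn, ← Int.cast_abs, Int.abs_eq_natAbs, ← hn]; push_cast; rfl
  rw [hΔR]
  calc (S.card : ℝ) * (Fintype.card Q * Λ.index) = Λ.index * ((S.card * Fintype.card Q : ℕ) : ℝ) := by
        push_cast; ring
    _ ≤ Λ.index * (11 * A) ^ (Fintype.card ι - 2) := by
        gcongr
        exact (Nat.cast_le.2 hcard).trans hbox

/-! ### Sizes of minors, and the bounds used for one set of reference quadruples. -/

theorem exists_divisor_weight_le (d : ℕ) (η : ℝ) (hη : 0 < η) :
    ∃ C : ℝ, 1 ≤ C ∧ ∀ X : ℝ, 1 ≤ X → ∀ n : ℕ, n ≠ 0 → (n : ℝ) ≤ 8 * X ^ (2 * d) →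
      (n.divisors.card : ℝ) * ((d ^ n.primeFactors.card : ℕ) : ℝ) ^ 2 ≤ C * X ^ η := by
  -- Three factors `n ^ e` with `n ≤ 8 X ^ (2d)` give `X ^ (6de)`, and `6de ≤ η`.
  set e : ℝ := η / (6 * d + 1) with he
  have he0 : 0 < e := by positivity
  obtain ⟨C₁, hC₁, h₁⟩ := card_divisors_le_rpow e he0
  obtain ⟨C₂, hC₂, h₂⟩ := pow_card_primeFactors_le_rpow d e he0
  refine ⟨C₁ * C₂ ^ 2 * (8 : ℝ) ^ (3 * e), ?_, fun X hX n hn hnX => ?_⟩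
  · have h3 : (1 : ℝ) ≤ 8 ^ (3 * e) := Real.one_le_rpow (by norm_num) (by positivity)
    exact one_le_mul_of_one_le_of_one_le
      (one_le_mul_of_one_le_of_one_le hC₁ (one_le_pow₀ hC₂)) h3
  have hX0 : 0 < X := by linarith
  have h4 : ((n : ℝ) ^ e) ^ 3 ≤ (8 : ℝ) ^ (3 * e) * X ^ η := by
    rw [← Real.rpow_natCast, ← Real.rpow_mul (by positivity)]
    calc (n : ℝ) ^ (e * (3 : ℕ)) ≤ (8 * X ^ (2 * d)) ^ (e * (3 : ℕ)) := by gcongr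
      _ = (8 : ℝ) ^ (3 * e) * X ^ ((2 * d : ℕ) * (e * (3 : ℕ))) := by
          rw [Real.mul_rpow (by norm_num) (by positivity), ← Real.rpow_natCast X,
            ← Real.rpow_mul hX0.le]
          congr 2; push_cast; ring
      _ ≤ _ := by
          refine mul_le_mul_of_nonneg_left (Real.rpow_le_rpow_of_exponent_le hX ?_) (by positivity)
          rw [he]; push_cast
          rw [← sub_nonneg]
          have : η - 2 * d * (η / (6 * d + 1) * 3) = η / (6 * d + 1) := by field_simp; ring
          rw [this]; positivity
  calc _ ≤ (C₁ * (n : ℝ) ^ e) * (C₂ * (n : ℝ) ^ e) ^ 2 := by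
        gcongr
        · exact h₁ n hn
        · exact h₂ n hn
    _ = C₁ * C₂ ^ 2 * ((n : ℝ) ^ e) ^ 3 := by ring
    _ ≤ C₁ * C₂ ^ 2 * ((8 : ℝ) ^ (3 * e) * X ^ η) := by gcongr
    _ = _ := by ring

theorem abs_minor_le {d : ℕ} {X : ℝ} {p q : (ℤ × ℤ) × (ℤ × ℤ)} (hp : p ∈ quads X)
    (hq : q ∈ quads X) : |(minor d p q : ℝ)| ≤ 8 * X ^ (2 * d) := by
  rw [quads, Finset.mem_product] at hp hq
  rw [minor]; push_cast
  have h1 := abs_powDiff_le (d := d) hp.1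
  have h2 := abs_powDiff_le (d := d) hp.2
  have h3 := abs_powDiff_le (d := d) hq.1
  have h4 := abs_powDiff_le (d := d) hq.2
  have h0 : 0 ≤ 2 * X ^ d := (abs_nonneg _).trans h1
  calc _ ≤ |(powDiff d p.1 : ℝ) * powDiff d q.2| + |(powDiff d p.2 : ℝ) * powDiff d q.1| := abs_sub _ _
    _ ≤ (2 * X ^ d) * (2 * X ^ d) + (2 * X ^ d) * (2 * X ^ d) := by
        rw [abs_mul, abs_mul]; gcongr
    _ = _ := by rw [two_mul d, pow_add]; ring

theorem le_vecNorm_of_minor_ne_zero {d : ℕ} (hd : 0 < d) {X : ℝ} (hX : 1 ≤ X)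
    {p q : (ℤ × ℤ) × (ℤ × ℤ)} (hp : p ∈ quads X) (h : minor d p q ≠ 0) :
    (X / 2) ^ (d - 1) ≤ vecNorm d p := by
  rw [quads, Finset.mem_product] at hp
  by_cases h1 : powDiff d p.1 = 0
  · have h2 : powDiff d p.2 ≠ 0 := by
      intro h2; apply h; rw [minor, h1, h2]; ring
    exact (le_abs_powDiff hd hX hp.2 h2).trans (le_max_right _ _)
  · exact (le_abs_powDiff hd hX hp.1 h1).trans (le_max_left _ _)

open Classical in
/-- The sum of the reciprocals of the large minors. -/
theorem sum_inv_minor_le {d : ℕ} (hd : 0 < d) {X : ℝ} (hX : 1 ≤ X) :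
    ∑ t₀ ∈ quads X, ∑ t₁ ∈ quads X, ∑ t₂ ∈ quads X,
      (if vecNorm d t₁ ≤ vecNorm d t₀ ∧ minor d t₀ t₁ ≠ 0 ∧
          |(minor d t₀ t₂ : ℝ)| ≤ |(minor d t₀ t₁ : ℝ)| ∧
          vecNorm d t₀ * (X / 2) ^ (d - 1) < |(minor d t₀ t₁ : ℝ)|
        then 1 / |(minor d t₀ t₁ : ℝ)| else 0) ≤
      162 ^ 2 * 81 * X ^ 10 / ((X / 2) ^ (d - 1)) ^ 2 := by
  have hX0 : 0 < X := by linarith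
  set Y := (X / 2) ^ (d - 1) with hY
  have hY0 : 0 < Y := by positivity
  -- Summing over `t₂` in its strip cancels `1 / |Δ|` and leaves `X ^ 3 / (vecNorm d t₀ * Y)`; the
  -- largeness of `Δ` makes the `+ 1` in the strip count harmless.
  have h2 : ∀ t₀ ∈ quads X, ∀ t₁ ∈ quads X, ∑ t₂ ∈ quads X,
      (if vecNorm d t₁ ≤ vecNorm d t₀ ∧ minor d t₀ t₁ ≠ 0 ∧
          |(minor d t₀ t₂ : ℝ)| ≤ |(minor d t₀ t₁ : ℝ)| ∧
          vecNorm d t₀ * Y < |(minor d t₀ t₁ : ℝ)|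
        then 1 / |(minor d t₀ t₁ : ℝ)| else 0) ≤
      if vecNorm d t₁ ≤ vecNorm d t₀ ∧ Y ≤ vecNorm d t₀ then
        162 * X ^ 3 / (vecNorm d t₀ * Y) else 0 := by
    intro t₀ h₀ t₁ h₁
    by_cases hc : vecNorm d t₁ ≤ vecNorm d t₀ ∧ minor d t₀ t₁ ≠ 0 ∧
        vecNorm d t₀ * Y < |(minor d t₀ t₁ : ℝ)|
    · obtain ⟨c1, c2, c3⟩ := hc
      have hN : Y ≤ vecNorm d t₀ := le_vecNorm_of_minor_ne_zero hd hX h₀ c2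
      have hN0 : 0 < vecNorm d t₀ := hY0.trans_le hN
      have hΔ : 0 < |(minor d t₀ t₁ : ℝ)| := abs_pos.2 (by exact_mod_cast c2)
      rw [if_pos ⟨c1, hN⟩]
      have h3 := card_quads_minor_le hd hX t₀ hN0 hΔ.le
      calc _ = ∑ t₂ ∈ quads X, (if |(minor d t₀ t₂ : ℝ)| ≤ |(minor d t₀ t₁ : ℝ)| then
            1 / |(minor d t₀ t₁ : ℝ)| else 0) := by
            refine Finset.sum_congr rfl fun t₂ _ => ?_
            simp only [c1, c2, c3, ne_eq, not_false_eq_true, true_and, and_true]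
        _ = (((quads X).filter fun q => |(minor d t₀ q : ℝ)| ≤ |(minor d t₀ t₁ : ℝ)|).card : ℝ) *
            (1 / |(minor d t₀ t₁ : ℝ)|) := by
            rw [← Finset.sum_filter, Finset.sum_const, nsmul_eq_mul]
        _ ≤ (54 * X ^ 3 * (2 * |(minor d t₀ t₁ : ℝ)| / (vecNorm d t₀ * Y) +
              |(minor d t₀ t₁ : ℝ)| / (vecNorm d t₀ * Y))) * (1 / |(minor d t₀ t₁ : ℝ)|) := by
            refine mul_le_mul_of_nonneg_right (h3.trans ?_) (by positivity)
            gcongr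
            rw [le_div_iff₀ (by positivity), one_mul]; exact c3.le
        _ = _ := by field_simp; ring
    · refine le_trans (le_of_eq (Finset.sum_eq_zero fun t₂ _ => if_neg ?_)) ?_
      · tauto
      · split_ifs with h
        · have : 0 < vecNorm d t₀ := hY0.trans_le h.2
          positivity
        · exact le_rfl
  -- Likewise the number of `t₁` no longer than `t₀` cancels `1 / vecNorm d t₀`; the sum over `t₀`
  -- is then trivial.
  have h1 : ∀ t₀ ∈ quads X, ∑ t₁ ∈ quads X,
      (if vecNorm d t₁ ≤ vecNorm d t₀ ∧ Y ≤ vecNorm d t₀ then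
        162 * X ^ 3 / (vecNorm d t₀ * Y) else 0) ≤ 162 ^ 2 * X ^ 6 / Y ^ 2 := by
    intro t₀ h₀
    by_cases hN : Y ≤ vecNorm d t₀
    · have hN0 : 0 < vecNorm d t₀ := hY0.trans_le hN
      have h3 := card_quads_vecNorm_le hd hX hN0.le
      simp only [hN, and_true]
      rw [← Finset.sum_filter, Finset.sum_const, nsmul_eq_mul]
      calc _ ≤ (54 * X ^ 3 * (2 * vecNorm d t₀ / Y + vecNorm d t₀ / Y)) *
            (162 * X ^ 3 / (vecNorm d t₀ * Y)) := by
            refine mul_le_mul_of_nonneg_right (h3.trans ?_) (by positivity)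
            gcongr
            rw [le_div_iff₀ (by positivity), one_mul]; exact hN
        _ = _ := by field_simp; ring
    · simp only [hN, and_false, if_false, Finset.sum_const_zero]
      positivity
  calc _ ≤ ∑ t₀ ∈ quads X, (162 ^ 2 * X ^ 6 / Y ^ 2) :=
        Finset.sum_le_sum fun t₀ h₀ => (Finset.sum_le_sum fun t₁ h₁ => h2 t₀ h₀ t₁ h₁).trans (h1 t₀ h₀)
    _ = (quads X).card * (162 ^ 2 * X ^ 6 / Y ^ 2) := by rw [Finset.sum_const, nsmul_eq_mul]
    _ ≤ (81 * X ^ 4) * (162 ^ 2 * X ^ 6 / Y ^ 2) := by gcongr; exact card_quads_le hX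
    _ = _ := by ring

/-- The condition on a further quadruple `q`, given two reference quadruples `t₀`, `t₁` of large
minor, a divisor `g` of all minors and a quadruple `p` whose vector is least divisible. -/
def Compatible (d : ℕ) (t₀ t₁ p : (ℤ × ℤ) × (ℤ × ℤ)) (g : ℕ) (q : (ℤ × ℤ) × (ℤ × ℤ)) : Prop :=
  gcdVec d g p ≤ gcdVec d g q ∧ (g : ℤ) ∣ minor d p q ∧
    |(minor d t₀ q : ℝ)| ≤ |(minor d t₀ t₁ : ℝ)|

-- For large `Δ` the congruence modulo `g` is used, and its `n`-th power gains `1 / g` against the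
-- factor `g` in the relation count. For small `Δ` the strip alone leaves `O(X ^ 3)` quadruples, and
-- `g ≤ |Δ|` suffices.
open Classical in
theorem card_compatible_pow_le {d : ℕ} (hd : 4 ≤ d) {n : ℕ} (hn : 2 * d - 2 ≤ n) {X : ℝ}
    (hX : 1 ≤ X) {t₀ t₁ p : (ℤ × ℤ) × (ℤ × ℤ)} (h₀ : t₀ ∈ quads X)
    (h : minor d t₀ t₁ ≠ 0) {g : ℕ} (hg : g ≠ 0) (hgd : (g : ℤ) ∣ minor d t₀ t₁) {M : ℝ}
    (hM1 : 1 ≤ M) (hM : (g.divisors.card : ℝ) * ((d ^ g.primeFactors.card : ℕ) : ℝ) ^ 2 ≤ M) :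
    (((quads X).filter (Compatible d t₀ t₁ p g)).card : ℝ) ^ n * (g / |(minor d t₀ t₁ : ℝ)|) ≤
      (324 * M) ^ n * (X ^ (3 * n) +
        if vecNorm d t₀ * (X / 2) ^ (d - 1) < |(minor d t₀ t₁ : ℝ)| then
          X ^ (4 * n) * (1 / |(minor d t₀ t₁ : ℝ)|) else 0) := by
  have hX0 : 0 < X := by linarith
  have hd0 : 0 < d := by omega
  set Y := (X / 2) ^ (d - 1) with hY
  have hY0 : 0 < Y := by positivity
  set Δ := |(minor d t₀ t₁ : ℝ)| with hΔ
  have hΔ0 : 0 < Δ := abs_pos.2 (by exact_mod_cast h)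
  have hN : Y ≤ vecNorm d t₀ := le_vecNorm_of_minor_ne_zero hd0 hX h₀ h
  have hN0 : 0 < vecNorm d t₀ := hY0.trans_le hN
  have hg1 : (1 : ℝ) ≤ g := by exact_mod_cast Nat.one_le_iff_ne_zero.2 hg
  have hgΔ : (g : ℝ) ≤ Δ := by
    have h1 := Int.le_of_dvd (abs_pos.2 h) ((dvd_abs _ _).2 hgd)
    rw [hΔ, ← Int.cast_abs]; exact_mod_cast h1
  have hgΔ1 : g / Δ ≤ 1 := (div_le_one hΔ0).2 hgΔ
  split_ifs with hc
  · have h1 : (((quads X).filter (Compatible d t₀ t₁ p g)).card : ℝ) ≤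
        162 * X ^ 4 * M * ((g : ℝ) ^ (-(2 / (3 * d) : ℝ)) + 1 / X) := by
      refine le_trans (Nat.cast_le.2 (Finset.card_le_card ?_))
        ((card_quads_dvd_minor_le hd0 hX hg p).trans ?_)
      · exact Finset.monotone_filter_right _ fun q _ hq => ⟨hq.1, hq.2.1⟩
      · gcongr
    -- This needs `2n ≥ 3d`. From `n ≥ 2d - 2` one has `2n ≥ 4d - 4`, which is at least `3d` exactly
    -- when `d ≥ 4`.
    have h2 : ((g : ℝ) ^ (-(2 / (3 * d) : ℝ))) ^ n ≤ 1 / g := by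
      rw [← Real.rpow_natCast, ← Real.rpow_mul (by positivity), one_div, ← Real.rpow_neg_one]
      refine Real.rpow_le_rpow_of_exponent_le hg1 ?_
      have hd4 : (4 : ℝ) ≤ d := by exact_mod_cast hd
      have hn' : (2 * d - 2 : ℝ) ≤ n := by
        have : 2 * d ≤ n + 2 := by omega
        have : (2 * d : ℝ) ≤ n + 2 := by exact_mod_cast this
        linarith
      rw [neg_mul, neg_le_neg_iff, div_mul_eq_mul_div, le_div_iff₀ (by positivity)]
      nlinarith
    have h3 : ((g : ℝ) ^ (-(2 / (3 * d) : ℝ)) + 1 / X) ^ n ≤ 2 ^ n * (1 / g + 1 / X ^ n) := by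
      have h4 := add_pow_le (a := (g : ℝ) ^ (-(2 / (3 * d) : ℝ))) (b := 1 / X) (by positivity)
        (by positivity) n
      refine h4.trans ?_
      rw [one_div_pow]
      have h5 : (2 : ℝ) ^ (n - 1) ≤ 2 ^ n := pow_le_pow_right₀ (by norm_num) (by omega)
      gcongr
    calc _ ≤ (162 * X ^ 4 * M * ((g : ℝ) ^ (-(2 / (3 * d) : ℝ)) + 1 / X)) ^ n * (g / Δ) := by
          gcongr
      _ = (162 * X ^ 4 * M) ^ n * ((g : ℝ) ^ (-(2 / (3 * d) : ℝ)) + 1 / X) ^ n * (g / Δ) := by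
          rw [mul_pow]
      _ ≤ (162 * X ^ 4 * M) ^ n * (2 ^ n * (1 / g + 1 / X ^ n)) * (g / Δ) := by gcongr
      _ = (324 * M) ^ n * (X ^ (4 * n) * (1 / X ^ n) * (g / Δ) + X ^ (4 * n) * (1 / Δ)) := by
          have e1 : (162 * X ^ 4 * M) ^ n * 2 ^ n = (324 * M) ^ n * X ^ (4 * n) := by
            rw [← mul_pow, pow_mul, ← mul_pow]; ring
          calc _ = ((162 * X ^ 4 * M) ^ n * 2 ^ n) * ((1 / g + 1 / X ^ n) * (g / Δ)) := by ring
            _ = _ := by rw [e1]; field_simp; ring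
      _ ≤ _ := by
          have e2 : X ^ (4 * n) * (1 / X ^ n) = X ^ (3 * n) := by
            rw [show 4 * n = 3 * n + n by ring, pow_add]; field_simp
          rw [e2]
          have : X ^ (3 * n) * (g / Δ) ≤ X ^ (3 * n) := mul_le_of_le_one_right (by positivity) hgΔ1
          gcongr
  · rw [add_zero]
    have h1 : (((quads X).filter (Compatible d t₀ t₁ p g)).card : ℝ) ≤ 162 * X ^ 3 := by
      refine le_trans (Nat.cast_le.2 (Finset.card_le_card ?_))
        ((card_quads_minor_le hd0 hX t₀ hN0 hΔ0.le).trans ?_)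
      · exact Finset.monotone_filter_right _ fun q _ hq => hq.2.2
      · have : Δ / (vecNorm d t₀ * Y) ≤ 1 := (div_le_one (by positivity)).2 (not_lt.1 hc)
        have e : 162 * X ^ 3 = 54 * X ^ 3 * (2 * 1 + 1) := by ring
        rw [e, mul_div_assoc]
        gcongr
    calc _ ≤ (162 * X ^ 3) ^ n * 1 := by gcongr
      _ = 162 ^ n * X ^ (3 * n) := by rw [mul_one, mul_pow, ← pow_mul]
      _ ≤ _ := by gcongr; linarith

/-! ### Families whose vectors span the plane. -/

/-- The vectors of quadruples indexed by `Fin s`. -/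
noncomputable def families (s : ℕ) (X : ℝ) : Finset (Fin s → (ℤ × ℤ) × (ℤ × ℤ)) :=
  Fintype.piFinset fun _ => quads X

/-- The coefficient vectors annihilated by a family of quadruples. -/
noncomputable def relations (d : ℕ) {s : ℕ} (A : ℝ) (q : Fin s → (ℤ × ℤ) × (ℤ × ℤ)) :
    Finset (Fin s → ℤ) :=
  (coeffBox (Fin s) A).filter fun a =>
    ∑ k, a k * powDiff d (q k).1 = 0 ∧ ∑ k, a k * powDiff d (q k).2 = 0

open Classical in
theorem card_families_fixed_le {s : ℕ} (X : ℝ) {i₀ i₁ i₂ : Fin s} (h01 : i₀ ≠ i₁) (h02 : i₀ ≠ i₂)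
    (h12 : i₁ ≠ i₂) (t₀ t₁ t₂ : (ℤ × ℤ) × (ℤ × ℤ)) (P : (ℤ × ℤ) × (ℤ × ℤ) → Prop) :
    ((families s X).filter fun q => q i₀ = t₀ ∧ q i₁ = t₁ ∧ q i₂ = t₂ ∧ ∀ j, P (q j)).card ≤
      ((quads X).filter P).card ^ (s - 3) := by
  have hcard : Fintype.card {k : Fin s // k ≠ i₀ ∧ k ≠ i₁ ∧ k ≠ i₂} = s - 3 := by
    rw [Fintype.card_subtype]
    have : (Finset.univ.filter fun k => k ≠ i₀ ∧ k ≠ i₁ ∧ k ≠ i₂) =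
        ((Finset.univ.erase i₀).erase i₁).erase i₂ := by
      ext k; simp; tauto
    rw [this, Finset.card_erase_of_mem (by simp [h02.symm, h12.symm]),
      Finset.card_erase_of_mem (by simp [h01.symm]), Finset.card_erase_of_mem (by simp),
      Finset.card_univ, Fintype.card_fin]
    omega
  calc _ ≤ (Fintype.piFinset fun _ : {k : Fin s // k ≠ i₀ ∧ k ≠ i₁ ∧ k ≠ i₂} =>
        (quads X).filter P).card := by
        refine Finset.card_le_card_of_injOn (fun q k => q k) ?_ ?_
        · intro q hq
          rw [Finset.mem_coe, Finset.mem_filter, families, Fintype.mem_piFinset] at hq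
          rw [Finset.mem_coe, Fintype.mem_piFinset]
          exact fun k => Finset.mem_filter.2 ⟨hq.1 k, hq.2.2.2.2 k⟩
        · intro q hq q' hq' heq
          rw [Finset.mem_coe, Finset.mem_filter] at hq hq'
          funext k
          by_cases h0 : k = i₀
          · rw [h0, hq.2.1, hq'.2.1]
          by_cases h1 : k = i₁
          · rw [h1, hq.2.2.1, hq'.2.2.1]
          by_cases h2 : k = i₂
          · rw [h2, hq.2.2.2.1, hq'.2.2.2.1]
          exact congrFun heq ⟨k, h0, h1, h2⟩
    _ = _ := by rw [Fintype.card_piFinset, Finset.prod_const, Finset.card_univ, hcard]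

/-- The choice of reference indices for a family of quadruples with vectors spanning the plane. -/
theorem exists_reference {d s : ℕ} (hs : 3 ≤ s) {X : ℝ} (q : Fin s → (ℤ × ℤ) × (ℤ × ℤ))
    (hq : q ∈ families s X) (hne : ∃ k l, minor d (q k) (q l) ≠ 0) :
    ∃ i₀ i₁ i₂ : Fin s, ∃ m : Fin 3, ∃ g : ℕ, i₀ ≠ i₁ ∧ i₀ ≠ i₂ ∧ i₁ ≠ i₂ ∧ g ≠ 0 ∧
      (g : ℤ) ∣ minor d (q i₀) (q i₁) ∧
      vecNorm d (q i₁) ≤ vecNorm d (q i₀) ∧ minor d (q i₀) (q i₁) ≠ 0 ∧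
      (∀ j, Compatible d (q i₀) (q i₁) (![q i₀, q i₁, q i₂] m) g (q j)) ∧
      ∀ A : ℝ, 1 ≤ A → X ^ (2 * d) ≤ A →
        ((relations d A q).card : ℝ) ≤ (11 * A) ^ (s - 2) * (g / |(minor d (q i₀) (q i₁) : ℝ)|) := by
  have : Nonempty (Fin s) := ⟨⟨0, by omega⟩⟩
  obtain ⟨i₀, -, hi₀⟩ := Finset.exists_max_image Finset.univ (fun i => vecNorm d (q i))
    Finset.univ_nonempty
  obtain ⟨i₁, -, hi₁⟩ := Finset.exists_max_image Finset.univ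
    (fun i => |(minor d (q i₀) (q i) : ℝ)|) Finset.univ_nonempty
  -- A vanishing maximum would make all vectors parallel to that of `q i₀`. If the latter is zero,
  -- so are all, by maximality of its norm; otherwise a linear identity between the minors kills
  -- every `minor d (q k) (q l)`.
  have hΔ : minor d (q i₀) (q i₁) ≠ 0 := by
    intro h0
    have hz : ∀ j, minor d (q i₀) (q j) = 0 := by
      intro j
      have := hi₁ j (Finset.mem_univ _)
      rw [h0] at this
      simpa using this
    obtain ⟨k, l, hkl⟩ := hne
    by_cases hu : powDiff d (q i₀).1 = 0 ∧ powDiff d (q i₀).2 = 0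
    · have hN : vecNorm d (q i₀) = 0 := by rw [vecNorm, hu.1, hu.2]; simp
      have hk := hi₀ k (Finset.mem_univ _)
      rw [hN] at hk
      have h1 : powDiff d (q k).1 = 0 := by
        have := (le_max_left _ _).trans hk
        simpa using this
      have h2 : powDiff d (q k).2 = 0 := by
        have := (le_max_right _ _).trans hk
        simpa using this
      apply hkl; rw [minor, h1, h2]; ring
    · have hk := hz k
      have hl := hz l
      rw [minor] at hk hl
      have e1 : powDiff d (q i₀).1 * minor d (q k) (q l) = 0 := by
        rw [minor]; linear_combination powDiff d (q k).1 * hl - powDiff d (q l).1 * hk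
      have e2 : powDiff d (q i₀).2 * minor d (q k) (q l) = 0 := by
        rw [minor]; linear_combination powDiff d (q k).2 * hl - powDiff d (q l).2 * hk
      exact hu ⟨(mul_eq_zero.1 e1).resolve_right hkl, (mul_eq_zero.1 e2).resolve_right hkl⟩
  have h01 : i₀ ≠ i₁ := by rintro rfl; apply hΔ; rw [minor]; ring
  obtain ⟨g, hg0, hgd, hga⟩ := exists_index_card_relations_le (fun k => powDiff d (q k).1)
    (fun k => powDiff d (q k).2) i₀ i₁ hΔ
  obtain ⟨j₀, -, hj₀⟩ := Finset.exists_min_image Finset.univ (fun i => gcdVec d g (q i))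
    Finset.univ_nonempty
  have hcompat : ∀ j, Compatible d (q i₀) (q i₁) (q j₀) g (q j) := fun j =>
    ⟨hj₀ j (Finset.mem_univ _), hgd j₀ j, hi₁ j (Finset.mem_univ _)⟩
  have hrel : ∀ A : ℝ, 1 ≤ A → X ^ (2 * d) ≤ A → ((relations d A q).card : ℝ) ≤
      (11 * A) ^ (s - 2) * (g / |(minor d (q i₀) (q i₁) : ℝ)|) := by
    intro A hA hXA
    have hq' := Fintype.mem_piFinset.1 hq
    have h1 := hga A hA ((abs_minor_le (hq' i₀) (hq' i₁)).trans (by linarith))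
    rw [Fintype.card_fin] at h1
    rw [← mul_div_assoc, le_div_iff₀ (abs_pos.2 (by exact_mod_cast hΔ)), mul_comm (_ ^ _)]
    exact h1
  -- The least divisible quadruple may sit at `i₀`, at `i₁` or elsewhere. Padding to three distinct
  -- indices, with `m` recording its position, treats the cases alike and always leaves `s - 3` free
  -- quadruples.
  obtain ⟨i₂, m, h02, h12, hm⟩ : ∃ i₂ : Fin s, ∃ m : Fin 3, i₀ ≠ i₂ ∧ i₁ ≠ i₂ ∧
      ![q i₀, q i₁, q i₂] m = q j₀ := by
    have hex : ∃ i₂ : Fin s, i₀ ≠ i₂ ∧ i₁ ≠ i₂ := by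
      by_contra! hcon
      have : (Finset.univ : Finset (Fin s)) ⊆ {i₀, i₁} := by
        intro k _
        rw [Finset.mem_insert, Finset.mem_singleton]
        by_cases hk : k = i₀
        · exact Or.inl hk
        · exact Or.inr (hcon k (Ne.symm hk)).symm
      have h3 := (Finset.card_le_card this).trans Finset.card_le_two
      rw [Finset.card_univ, Fintype.card_fin] at h3
      omega
    obtain ⟨i₂, h1, h2⟩ := hex
    by_cases c0 : j₀ = i₀
    · exact ⟨i₂, 0, h1, h2, by rw [c0]; rfl⟩
    by_cases c1 : j₀ = i₁
    · exact ⟨i₂, 1, h1, h2, by rw [c1]; rfl⟩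
    exact ⟨j₀, 2, Ne.symm c0, Ne.symm c1, rfl⟩
  exact ⟨i₀, i₁, i₂, m, g, h01, h02, h12, hg0, hgd i₀ i₁, hi₀ i₁ (Finset.mem_univ _), hΔ,
    fun j => by rw [hm]; exact hcompat j, hrel⟩

/-- A weighted union bound: it replaces a choice of reference data depending on the family by a sum
over all possible data. -/
theorem sum_le_sum_card_mul {α β : Type*} (S : Finset α) (I : Finset β) (f : α → ℝ) (w : β → ℝ)
    (W : β → Finset α) (hWS : ∀ b, W b ⊆ S) (hw : ∀ b ∈ I, 0 ≤ w b)
    (h : ∀ a ∈ S, ∃ b ∈ I, a ∈ W b ∧ f a ≤ w b) :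
    ∑ a ∈ S, f a ≤ ∑ b ∈ I, ((W b).card : ℝ) * w b := by
  classical
  calc ∑ a ∈ S, f a ≤ ∑ a ∈ S, ∑ b ∈ I, if a ∈ W b then w b else 0 := by
        refine Finset.sum_le_sum fun a ha => ?_
        obtain ⟨b, hb, hR, hf⟩ := h a ha
        refine hf.trans ?_
        have := Finset.single_le_sum (f := fun b => if a ∈ W b then w b else 0) (s := I)
          (fun b hb => by split_ifs; exacts [hw b hb, le_rfl]) hb
        simpa [hR] using this
    _ = ∑ b ∈ I, ∑ a ∈ S, if a ∈ W b then w b else 0 := Finset.sum_comm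
    _ = _ := by
        refine Finset.sum_congr rfl fun b _ => ?_
        rw [← Finset.sum_filter, Finset.sum_const, nsmul_eq_mul, Finset.filter_mem_eq_inter,
          Finset.inter_eq_right.2 (hWS b)]

open Classical in
/-- The contribution of the families whose vectors span the plane. -/
theorem sum_relations_of_minor_ne_zero_le {d s : ℕ} (hd : 4 ≤ d) (hs : 2 * d + 1 ≤ s) (ε : ℝ)
    (hε : 0 < ε) : ∃ C : ℝ, 0 ≤ C ∧ ∀ A X : ℝ, 1 ≤ X → X ^ (2 * d) ≤ A →
      ∑ q ∈ (families s X).filter (fun q => ∃ k l, minor d (q k) (q l) ≠ 0),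
        ((relations d A q).card : ℝ) ≤
      C * (A ^ (s - 2) * X ^ ε * (X ^ (3 * s + 3) + X ^ (4 * s - 2 * d))) := by
  have hs0 : (0 : ℝ) < s := by exact_mod_cast (by omega : 0 < s)
  obtain ⟨C₀, hC₀, hM⟩ := exists_divisor_weight_le d (ε / s) (by positivity)
  set n := s - 3 with hn
  set idx : Finset ((Fin s × Fin s × Fin s) × Fin 3) :=
    Finset.univ.filter fun i => i.1.1 ≠ i.1.2.1 ∧ i.1.1 ≠ i.1.2.2 ∧ i.1.2.1 ≠ i.1.2.2 with hidx
  set c₁ : ℝ := 162 ^ 2 * 81 ^ 3 * 2 ^ (2 * d) with hc₁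
  refine ⟨idx.card * (C₀ * (11 ^ (s - 2) * ((324 * C₀) ^ n * c₁))), by positivity,
    fun A X hX hA => ?_⟩
  have hX0 : 0 < X := by linarith
  have hA1 : 1 ≤ A := (one_le_pow₀ hX).trans hA
  set M : ℝ := C₀ * X ^ (ε / s) with hMdef
  have hM1 : 1 ≤ M := one_le_mul_of_one_le_of_one_le hC₀ (Real.one_le_rpow hX (by positivity))
  let Quad := (ℤ × ℤ) × (ℤ × ℤ)
  set T : Finset (Quad × Quad × Quad) := (quads X ×ˢ quads X ×ˢ quads X).filter fun t =>
    vecNorm d t.2.1 ≤ vecNorm d t.1 ∧ minor d t.1 t.2.1 ≠ 0 ∧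
      |(minor d t.1 t.2.2 : ℝ)| ≤ |(minor d t.1 t.2.1 : ℝ)| with hT
  set I : Finset (((Fin s × Fin s × Fin s) × Fin 3) × (Σ _ : Quad × Quad × Quad, ℕ)) :=
    idx ×ˢ T.sigma fun t => (minor d t.1 t.2.1).natAbs.divisors with hI
  set S := (families s X).filter fun q => ∃ k l, minor d (q k) (q l) ≠ 0 with hS
  have hcover := sum_le_sum_card_mul S I (fun q => ((relations d A q).card : ℝ))
    (fun b => (11 * A) ^ (s - 2) * (b.2.2 / |(minor d b.2.1.1 b.2.1.2.1 : ℝ)|))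
    (fun b => S.filter fun q =>
      q b.1.1.1 = b.2.1.1 ∧ q b.1.1.2.1 = b.2.1.2.1 ∧ q b.1.1.2.2 = b.2.1.2.2 ∧
      ∀ j, Compatible d b.2.1.1 b.2.1.2.1 (![b.2.1.1, b.2.1.2.1, b.2.1.2.2] b.1.2) b.2.2 (q j))
    (fun b => Finset.filter_subset _ _) (fun b _ => by positivity) (by
      intro q hq
      obtain ⟨hq1, hq2⟩ := Finset.mem_filter.1 hq
      obtain ⟨i₀, i₁, i₂, m, g, h01, h02, h12, hg0, hgd, hN, hΔ, hcomp, hrel⟩ :=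
        exists_reference (by omega) q hq1 hq2
      have hq' := Fintype.mem_piFinset.1 hq1
      refine ⟨(((i₀, i₁, i₂), m), ⟨(q i₀, q i₁, q i₂), g⟩), ?_,
        Finset.mem_filter.2 ⟨hq, rfl, rfl, rfl, hcomp⟩, hrel A hA1 hA⟩
      rw [hI, Finset.mem_product, Finset.mem_sigma, hT, hidx]
      simp only [Finset.mem_filter, Finset.mem_univ, true_and, Finset.mem_product,
        Nat.mem_divisors]
      exact ⟨⟨h01, h02, h12⟩, ⟨⟨hq' i₀, hq' i₁, hq' i₂⟩, hN, hΔ, (hcomp i₂).2.2⟩,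
        Int.natCast_dvd.1 hgd, Int.natAbs_ne_zero.2 hΔ⟩)
  refine hcover.trans ?_
  rw [hI, Finset.sum_product]
  set G : Quad × Quad × Quad → ℝ := fun t =>
    if vecNorm d t.1 * (X / 2) ^ (d - 1) < |(minor d t.1 t.2.1 : ℝ)| then
          1 / |(minor d t.1 t.2.1 : ℝ)| else 0 with hG
  have hinner : ∀ i ∈ idx, ∑ b ∈ T.sigma (fun t => (minor d t.1 t.2.1).natAbs.divisors),
      ((S.filter fun q => q i.1.1 = b.1.1 ∧ q i.1.2.1 = b.1.2.1 ∧ q i.1.2.2 = b.1.2.2 ∧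
      ∀ j, Compatible d b.1.1 b.1.2.1 (![b.1.1, b.1.2.1, b.1.2.2] i.2) b.2 (q j)).card : ℝ) *
        ((11 * A) ^ (s - 2) * (b.2 / |(minor d b.1.1 b.1.2.1 : ℝ)|)) ≤
      M * ((11 * A) ^ (s - 2) * ((324 * M) ^ n * (c₁ * (X ^ (3 * s + 3) + X ^ (4 * s - 2 * d))))) := by
    intro i hi
    obtain ⟨h01, h02, h12⟩ := (Finset.mem_filter.1 hi).2
    rw [Finset.sum_sigma]
    have hterm : ∀ t ∈ T, ∑ g ∈ (minor d t.1 t.2.1).natAbs.divisors,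
        ((S.filter fun q => q i.1.1 = t.1 ∧ q i.1.2.1 = t.2.1 ∧ q i.1.2.2 = t.2.2 ∧
        ∀ j, Compatible d t.1 t.2.1 (![t.1, t.2.1, t.2.2] i.2) g (q j)).card : ℝ) *
          ((11 * A) ^ (s - 2) * (g / |(minor d t.1 t.2.1 : ℝ)|)) ≤
        M * ((11 * A) ^ (s - 2) * ((324 * M) ^ n * (X ^ (3 * n) + X ^ (4 * n) * G t))) := by
      intro t ht
      obtain ⟨ht1, ht2, ht3, ht4⟩ := Finset.mem_filter.1 ht
      rw [Finset.mem_product, Finset.mem_product] at ht1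
      obtain ⟨hq0, hq1, hq2⟩ := ht1
      have hG0 : 0 ≤ G t := by rw [hG]; dsimp only; split_ifs <;> positivity
      have hΔle : (((minor d t.1 t.2.1).natAbs : ℕ) : ℝ) ≤ 8 * X ^ (2 * d) := by
        rw [Nat.cast_natAbs, Int.cast_abs]; exact abs_minor_le hq0 hq1
      have hτ : ((minor d t.1 t.2.1).natAbs.divisors.card : ℝ) ≤ M := by
        refine le_trans ?_ (hM X hX _ (Int.natAbs_ne_zero.2 ht3) hΔle)
        refine le_mul_of_one_le_right (by positivity) (one_le_pow₀ ?_)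
        exact_mod_cast Nat.one_le_pow _ _ (by omega)
      calc _ ≤ ∑ g ∈ (minor d t.1 t.2.1).natAbs.divisors, (11 * A) ^ (s - 2) *
            ((324 * M) ^ n * (X ^ (3 * n) + X ^ (4 * n) * G t)) := by
            refine Finset.sum_le_sum fun g hg => ?_
            obtain ⟨hg1, hg2⟩ := Nat.mem_divisors.1 hg
            have hg0 : g ≠ 0 := ne_zero_of_dvd_ne_zero hg2 hg1
            have hgM := hM X hX g hg0 (le_trans (Nat.cast_le.2
              (Nat.le_of_dvd (Nat.pos_of_ne_zero hg2) hg1)) hΔle)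
            have h1 := card_compatible_pow_le hd (n := n) (by omega) hX
              (p := ![t.1, t.2.1, t.2.2] i.2) hq0 ht3 hg0 (Int.natCast_dvd.2 hg1) hM1 hgM
            have h2 := card_families_fixed_le X h01 h02 h12 t.1 t.2.1 t.2.2
              (Compatible d t.1 t.2.1 (![t.1, t.2.1, t.2.2] i.2) g)
            have h3 : ((S.filter fun q => q i.1.1 = t.1 ∧ q i.1.2.1 = t.2.1 ∧ q i.1.2.2 = t.2.2 ∧
                ∀ j, Compatible d t.1 t.2.1 (![t.1, t.2.1, t.2.2] i.2) g (q j)).card : ℝ) ≤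
                (((quads X).filter (Compatible d t.1 t.2.1
                  (![t.1, t.2.1, t.2.2] i.2) g)).card : ℝ) ^ n := by
              refine le_trans (Nat.cast_le.2 (Finset.card_le_card
                (Finset.filter_subset_filter _ (Finset.filter_subset _ _)))) ?_
              exact_mod_cast h2
            have h4 : (324 * M) ^ n * (X ^ (3 * n) +
                if vecNorm d t.1 * (X / 2) ^ (d - 1) < |(minor d t.1 t.2.1 : ℝ)| then
                  X ^ (4 * n) * (1 / |(minor d t.1 t.2.1 : ℝ)|) else 0) =
                (324 * M) ^ n * (X ^ (3 * n) + X ^ (4 * n) * G t) := by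
              rw [hG]; dsimp only; rw [mul_ite, mul_zero]
            rw [h4] at h1
            calc _ ≤ (((quads X).filter (Compatible d t.1 t.2.1
                  (![t.1, t.2.1, t.2.2] i.2) g)).card : ℝ) ^ n *
                  ((11 * A) ^ (s - 2) * (g / |(minor d t.1 t.2.1 : ℝ)|)) := by gcongr
              _ = (11 * A) ^ (s - 2) * ((((quads X).filter (Compatible d t.1 t.2.1
                  (![t.1, t.2.1, t.2.2] i.2) g)).card : ℝ) ^ n *
                    (g / |(minor d t.1 t.2.1 : ℝ)|)) := by ring
              _ ≤ _ := by gcongr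
        _ = ((minor d t.1 t.2.1).natAbs.divisors.card : ℝ) * ((11 * A) ^ (s - 2) *
            ((324 * M) ^ n * (X ^ (3 * n) + X ^ (4 * n) * G t))) := by
            rw [Finset.sum_const, nsmul_eq_mul]
        _ ≤ _ := by gcongr
    refine (Finset.sum_le_sum hterm).trans ?_
    rw [← Finset.mul_sum, ← Finset.mul_sum, ← Finset.mul_sum, Finset.sum_add_distrib,
      ← Finset.mul_sum, Finset.sum_const, nsmul_eq_mul]
    have hTcard : (T.card : ℝ) ≤ 81 ^ 3 * X ^ 12 := by
      calc (T.card : ℝ) ≤ ((quads X ×ˢ quads X ×ˢ quads X).card : ℝ) :=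
            Nat.cast_le.2 (Finset.card_filter_le _ _)
        _ = (quads X).card * ((quads X).card * (quads X).card) := by
            rw [Finset.card_product, Finset.card_product]; push_cast; rfl
        _ ≤ (81 * X ^ 4) * ((81 * X ^ 4) * (81 * X ^ 4)) := by
            have := card_quads_le hX
            gcongr
        _ = _ := by ring
    have hGsum : ∑ t ∈ T, G t ≤ 162 ^ 2 * 81 * X ^ 10 / ((X / 2) ^ (d - 1)) ^ 2 := by
      refine le_trans (le_of_eq ?_) (sum_inv_minor_le (by omega : 0 < d) hX)
      rw [hT, Finset.sum_filter, Finset.sum_product]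
      refine Finset.sum_congr rfl fun t₀ _ => ?_
      rw [Finset.sum_product]
      refine Finset.sum_congr rfl fun t₁ _ => Finset.sum_congr rfl fun t₂ _ => ?_
      rw [hG]; dsimp only
      rw [← ite_and]
      simp only [and_assoc]
    -- Exponents with `n = s - 3`: `12 + 3n = 3s + 3`, and below `4n + 10 = (4s - 2d) + 2(d - 1)`.
    have e1 : X ^ 12 * X ^ (3 * n) = X ^ (3 * s + 3) := by
      rw [← pow_add]; congr 1; omega
    have e2 : X ^ (4 * n) * (X ^ 10 / ((X / 2) ^ (d - 1)) ^ 2) ≤ 2 ^ (2 * d) * X ^ (4 * s - 2 * d) := by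
      have e3 : X ^ (4 * n) * X ^ 10 = X ^ (4 * s - 2 * d) * X ^ (2 * (d - 1)) := by
        rw [← pow_add, ← pow_add]; congr 1; omega
      rw [← mul_div_assoc, e3, div_pow, div_pow, ← pow_mul, ← pow_mul, mul_comm (d - 1) 2]
      have e4 : X ^ (4 * s - 2 * d) * X ^ (2 * (d - 1)) / (X ^ (2 * (d - 1)) / 2 ^ (2 * (d - 1))) =
          2 ^ (2 * (d - 1)) * X ^ (4 * s - 2 * d) := by field_simp
      rw [e4]
      gcongr
      · norm_num
      · omega
    have hsum : T.card * X ^ (3 * n) + X ^ (4 * n) * ∑ t ∈ T, G t ≤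
        c₁ * (X ^ (3 * s + 3) + X ^ (4 * s - 2 * d)) := by
      have hp : (1 : ℝ) ≤ 2 ^ (2 * d) := one_le_pow₀ (by norm_num)
      calc _ ≤ 81 ^ 3 * X ^ 12 * X ^ (3 * n) +
            X ^ (4 * n) * (162 ^ 2 * 81 * X ^ 10 / ((X / 2) ^ (d - 1)) ^ 2) := by gcongr
        _ = 81 ^ 3 * (X ^ 12 * X ^ (3 * n)) +
            162 ^ 2 * 81 * (X ^ (4 * n) * (X ^ 10 / ((X / 2) ^ (d - 1)) ^ 2)) := by ring
        _ ≤ 81 ^ 3 * X ^ (3 * s + 3) + 162 ^ 2 * 81 * (2 ^ (2 * d) * X ^ (4 * s - 2 * d)) := by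
            rw [e1]; gcongr
        _ ≤ c₁ * X ^ (3 * s + 3) + c₁ * X ^ (4 * s - 2 * d) := by
            have h1 : (81 : ℝ) ^ 3 ≤ c₁ := by rw [hc₁]; nlinarith
            have h2 : (162 : ℝ) ^ 2 * 81 * 2 ^ (2 * d) ≤ c₁ := by rw [hc₁]; nlinarith
            rw [← mul_assoc]
            gcongr
        _ = _ := by ring
    gcongr
  refine (Finset.sum_le_sum hinner).trans ?_
  rw [Finset.sum_const, nsmul_eq_mul]
  -- One factor `M` counts the divisors `g`, the others come from the `n` free quadruples; `n + 1 ≤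
  -- s` explains the exponent `ε / s` in `M`.
  have hMpow : M * M ^ n ≤ C₀ * C₀ ^ n * X ^ ε := by
    rw [← pow_succ', ← pow_succ', hMdef, mul_pow, ← Real.rpow_natCast (X ^ (ε / s)),
      ← Real.rpow_mul hX0.le]
    refine mul_le_mul_of_nonneg_left (Real.rpow_le_rpow_of_exponent_le hX ?_) (by positivity)
    have : ((n + 1 : ℕ) : ℝ) ≤ s := by exact_mod_cast (by omega : n + 1 ≤ s)
    rw [div_mul_eq_mul_div, div_le_iff₀ hs0]
    gcongr
  calc _ = idx.card * ((11 * A) ^ (s - 2) * (324 ^ n * (c₁ * (X ^ (3 * s + 3) + X ^ (4 * s - 2 * d))) *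
        (M * M ^ n))) := by rw [mul_pow 324 M]; ring
    _ ≤ idx.card * ((11 * A) ^ (s - 2) * (324 ^ n * (c₁ * (X ^ (3 * s + 3) + X ^ (4 * s - 2 * d))) *
        (C₀ * C₀ ^ n * X ^ ε))) := by gcongr
    _ = _ := by rw [mul_pow 11 A, mul_pow 324 C₀]; ring

/-- The trivial bound for a family whose vectors span the plane. -/
theorem card_relations_le_of_minor_ne_zero {d s : ℕ} (hs : 3 ≤ s) {A X : ℝ} (hA : 1 ≤ A)
    (hXA : X ^ (2 * d) ≤ A) {q : Fin s → (ℤ × ℤ) × (ℤ × ℤ)} (hq : q ∈ families s X)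
    (hne : ∃ k l, minor d (q k) (q l) ≠ 0) :
    ((relations d A q).card : ℝ) ≤ (11 * A) ^ (s - 2) := by
  obtain ⟨i₀, i₁, i₂, m, g, -, -, -, -, hgd, -, hΔ, -, hrel⟩ := exists_reference hs q hq hne
  refine (hrel A hA hXA).trans (mul_le_of_le_one_right (by positivity) ?_)
  have hΔ0 : 0 < |(minor d (q i₀) (q i₁) : ℝ)| := abs_pos.2 (by exact_mod_cast hΔ)
  have h1 := Int.le_of_dvd (abs_pos.2 hΔ) ((dvd_abs _ _).2 hgd)
  rw [div_le_one hΔ0, ← Int.cast_abs]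
  exact_mod_cast h1

theorem card_families_le {s : ℕ} {X : ℝ} (hX : 1 ≤ X) :
    ((families s X).card : ℝ) ≤ (81 * X ^ 4) ^ s := by
  rw [families, Fintype.card_piFinset, Finset.prod_const, Finset.card_univ, Fintype.card_fin]
  push_cast
  exact pow_le_pow_left₀ (by positivity) (card_quads_le hX) s

/-! ### Families whose vectors are all parallel. -/

/-- Few quadruples have a vector parallel to a given one with nonzero components. -/
theorem card_quads_minor_eq_zero_le {d : ℕ} (hd : 2 ≤ d) (η : ℝ) (hη : 0 < η) :
    ∃ C : ℝ, 1 ≤ C ∧ ∀ X : ℝ, 1 ≤ X → ∀ t : (ℤ × ℤ) × (ℤ × ℤ), powDiff d t.1 ≠ 0 →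
      powDiff d t.2 ≠ 0 →
      (((quads X).filter fun q => minor d t q = 0).card : ℝ) ≤ C * (X ^ 2 * X ^ η) := by
  classical
  obtain ⟨C₀, hC₀, hτ⟩ := exists_divisor_weight_le d η hη
  refine ⟨9 * (2 * d * C₀) + 36, by nlinarith [(by positivity : (0 : ℝ) ≤ d * C₀)],
    fun X hX t h1 h2 => ?_⟩
  have hX0 : 0 < X := by linarith
  set Z := (pairs X).filter fun p => powDiff d p = 0 with hZ
  have hZc : (Z.card : ℝ) ≤ 6 * X := card_pairs_powDiff_zero_le (by omega) hX
  -- Either both components of `q` vanish, with `O(X ^ 2)` choices, or the first pair, also with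
  -- `O(X ^ 2)` choices, prescribes a nonzero value for the second, which has few representations.
  have hsub : ((quads X).filter fun q => minor d t q = 0) ⊆
      ((quads X).filter fun q => powDiff d q.1 ≠ 0 ∧ minor d t q = 0) ∪ Z ×ˢ Z := by
    intro q hq
    obtain ⟨hq1, hq2⟩ := Finset.mem_filter.1 hq
    rw [Finset.mem_union]
    by_cases h : powDiff d q.1 = 0
    · right
      rw [minor, h, mul_zero, sub_zero] at hq2
      rw [quads, Finset.mem_product] at hq1
      rw [Finset.mem_product]
      exact ⟨Finset.mem_filter.2 ⟨hq1.1, h⟩,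
        Finset.mem_filter.2 ⟨hq1.2, (mul_eq_zero.1 hq2).resolve_left h1⟩⟩
    · left; exact Finset.mem_filter.2 ⟨hq1, h, hq2⟩
  have hmain : (((quads X).filter fun q => powDiff d q.1 ≠ 0 ∧ minor d t q = 0).card : ℝ) ≤
      9 * X ^ 2 * (2 * d * (C₀ * X ^ η)) := by
    refine card_filter_product_le _ _ (fun a b => powDiff d a ≠ 0 ∧ minor d t (a, b) = 0)
      (by positivity) (card_pairs_le hX) fun a _ => ?_
    rcases ((pairs X).filter fun b => powDiff d a ≠ 0 ∧ minor d t (a, b) = 0).eq_empty_or_nonempty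
      with h | ⟨b₀, hb₀⟩
    · rw [h]; simp only [Finset.card_empty, Nat.cast_zero]; positivity
    obtain ⟨hb1, ha, hb2⟩ := Finset.mem_filter.1 hb₀
    rw [minor] at hb2
    have hv : powDiff d b₀ ≠ 0 := by
      intro h0
      rw [h0, mul_zero, zero_sub, neg_eq_zero] at hb2
      exact (mul_ne_zero h2 ha) hb2
    have h3 := card_pairs_powDiff_eq_le hd X hv
    have h4 := hτ X hX _ (Int.natAbs_ne_zero.2 hv) (by
      rw [Nat.cast_natAbs, Int.cast_abs]
      refine (abs_powDiff_le hb1).trans ?_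
      have : X ^ d ≤ X ^ (2 * d) := pow_le_pow_right₀ hX (by omega)
      nlinarith [pow_pos hX0 d])
    have h5 : ((powDiff d b₀).natAbs.divisors.card : ℝ) ≤ C₀ * X ^ η := by
      refine le_trans (le_mul_of_one_le_right (by positivity) (one_le_pow₀ ?_)) h4
      exact_mod_cast Nat.one_le_pow _ _ (by omega)
    have h6 : ((pairs X).filter fun b => powDiff d a ≠ 0 ∧ minor d t (a, b) = 0) ⊆
        (pairs X).filter fun b => powDiff d b = powDiff d b₀ := by
      refine Finset.monotone_filter_right _ fun b _ hb => ?_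
      have hb' := hb.2
      rw [minor] at hb'
      exact mul_left_cancel₀ h1 (by linarith)
    calc _ ≤ ((2 * d * (powDiff d b₀).natAbs.divisors.card : ℕ) : ℝ) :=
          Nat.cast_le.2 ((Finset.card_le_card h6).trans h3)
      _ = 2 * d * ((powDiff d b₀).natAbs.divisors.card : ℝ) := by push_cast; rfl
      _ ≤ _ := by gcongr
  have hXη : 1 ≤ X ^ η := Real.one_le_rpow hX hη.le
  calc _ ≤ (((quads X).filter fun q => powDiff d q.1 ≠ 0 ∧ minor d t q = 0).card : ℝ) +
        Z.card * Z.card := by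
        rw [← Nat.cast_mul, ← Finset.card_product, ← Nat.cast_add]
        exact Nat.cast_le.2 ((Finset.card_le_card hsub).trans (Finset.card_union_le _ _))
    _ ≤ 9 * X ^ 2 * (2 * d * (C₀ * X ^ η)) + (6 * X) * (6 * X) := by gcongr
    _ ≤ 9 * X ^ 2 * (2 * d * (C₀ * X ^ η)) + (6 * X) * (6 * X) * X ^ η := by
        exact add_le_add_right (le_mul_of_one_le_right (by positivity) hXη) _
    _ = _ := by ring

open Classical in
theorem card_families_fixed_one_le {s : ℕ} (X : ℝ) (i : Fin s) (t : (ℤ × ℤ) × (ℤ × ℤ))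
    (P : (ℤ × ℤ) × (ℤ × ℤ) → Prop) :
    ((families s X).filter fun q => q i = t ∧ ∀ j, P (q j)).card ≤
      ((quads X).filter P).card ^ (s - 1) := by
  have hcard : Fintype.card {k : Fin s // k ≠ i} = s - 1 := by
    rw [Fintype.card_subtype_compl, Fintype.card_subtype_eq, Fintype.card_fin]
  calc _ ≤ (Fintype.piFinset fun _ : {k : Fin s // k ≠ i} => (quads X).filter P).card := by
        refine Finset.card_le_card_of_injOn (fun q k => q k) ?_ ?_
        · intro q hq
          rw [Finset.mem_coe, Finset.mem_filter, families, Fintype.mem_piFinset] at hq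
          rw [Finset.mem_coe, Fintype.mem_piFinset]
          exact fun k => Finset.mem_filter.2 ⟨hq.1 k, hq.2.2 k⟩
        · intro q hq q' hq' heq
          rw [Finset.mem_coe, Finset.mem_filter] at hq hq'
          funext k
          by_cases h0 : k = i
          · rw [h0, hq.2.1, hq'.2.1]
          exact congrFun heq ⟨k, h0⟩
    _ = _ := by rw [Fintype.card_piFinset, Finset.prod_const, Finset.card_univ, hcard]

open Classical in
/-- The contribution of the families whose vectors are all parallel. -/
theorem sum_relations_of_minor_eq_zero_le {d s : ℕ} (hd : 4 ≤ d) (hs : 1 ≤ s) :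
    ∃ C : ℝ, 0 ≤ C ∧ ∀ A X : ℝ, 1 ≤ X → X ^ (2 * d) ≤ A →
      ∑ q ∈ (families s X).filter (fun q => (∀ k l, minor d (q k) (q l) = 0) ∧
          (∃ k, powDiff d (q k).1 ≠ 0) ∧ ∃ k, powDiff d (q k).2 ≠ 0),
        ((relations d A q).card : ℝ) ≤ C * (A ^ s * X ^ (2 * s)) := by
  have hs0 : (0 : ℝ) < s := by exact_mod_cast (by omega : 0 < s)
  obtain ⟨C₀, hC₀, hK⟩ := card_quads_minor_eq_zero_le (by omega : 2 ≤ d) (1 / s) (by positivity)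
  refine ⟨s * (81 * (C₀ ^ (s - 1) * 3 ^ (s - 1))), by positivity, fun A X hX hA => ?_⟩
  have hX0 : 0 < X := by linarith
  have hA1 : 1 ≤ A := (one_le_pow₀ hX).trans hA
  set S := (families s X).filter (fun q => (∀ k l, minor d (q k) (q l) = 0) ∧
          (∃ k, powDiff d (q k).1 ≠ 0) ∧ ∃ k, powDiff d (q k).2 ≠ 0) with hS
  set I : Finset (Fin s × ((ℤ × ℤ) × (ℤ × ℤ))) := Finset.univ ×ˢ (quads X).filter fun t =>
    powDiff d t.1 ≠ 0 ∧ powDiff d t.2 ≠ 0 with hI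
  refine (sum_le_sum_card_mul S I (fun q => ((relations d A q).card : ℝ))
    (fun _ => (3 * A) ^ (s - 1))
    (fun b => S.filter fun q => q b.1 = b.2 ∧ ∀ j, minor d b.2 (q j) = 0)
    (fun _ => Finset.filter_subset _ _) (fun _ _ => by positivity) ?_).trans ?_
  · intro q hq
    obtain ⟨hq1, hmin, ⟨k, hk⟩, ⟨l, hl⟩⟩ := Finset.mem_filter.1 hq
    have hq' := Fintype.mem_piFinset.1 hq1
    -- Parallelism puts both nonvanishing components at the same index, as
    -- `card_quads_minor_eq_zero_le` requires.
    have hk2 : powDiff d (q k).2 ≠ 0 := by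
      intro h0
      have h1 := hmin k l
      rw [minor, h0, zero_mul, sub_zero] at h1
      exact (mul_ne_zero hk hl) h1
    refine ⟨(k, q k), ?_, Finset.mem_filter.2 ⟨hq, rfl, hmin k⟩, ?_⟩
    · rw [hI, Finset.mem_product]
      exact ⟨Finset.mem_univ _, Finset.mem_filter.2 ⟨hq' k, hk, hk2⟩⟩
    · have h1 := card_relations_le_of_ne_zero (fun k => powDiff d (q k).1) k hk hA1
      rw [Fintype.card_fin] at h1
      refine le_trans (Nat.cast_le.2 (Finset.card_le_card ?_)) h1
      exact Finset.monotone_filter_right _ fun a _ ha => ha.1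
  · have hterm : ∀ b ∈ I, ((S.filter fun q => q b.1 = b.2 ∧ ∀ j, minor d b.2 (q j) = 0).card : ℝ) *
        (3 * A) ^ (s - 1) ≤ (C₀ * (X ^ 2 * X ^ (1 / s : ℝ))) ^ (s - 1) * (3 * A) ^ (s - 1) := by
      intro b hb
      obtain ⟨-, hb2⟩ := Finset.mem_product.1 hb
      obtain ⟨-, h1, h2⟩ := Finset.mem_filter.1 hb2
      have h3 := card_families_fixed_one_le X b.1 b.2 (fun q => minor d b.2 q = 0)
      refine mul_le_mul_of_nonneg_right ?_ (by positivity)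
      calc _ ≤ (((quads X).filter fun q => minor d b.2 q = 0).card : ℝ) ^ (s - 1) := by
            refine le_trans (Nat.cast_le.2 (Finset.card_le_card
              (Finset.filter_subset_filter _ (Finset.filter_subset _ _)))) ?_
            exact_mod_cast h3
        _ ≤ _ := pow_le_pow_left₀ (by positivity) (hK X hX b.2 h1 h2) _
    refine (Finset.sum_le_sum hterm).trans ?_
    rw [Finset.sum_const, nsmul_eq_mul]
    have hIc : (I.card : ℝ) ≤ s * (81 * X ^ 4) := by
      rw [hI, Finset.card_product, Finset.card_univ, Fintype.card_fin]
      push_cast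
      gcongr
      exact le_trans (Nat.cast_le.2 (Finset.card_filter_le _ _)) (card_quads_le hX)
    -- The choice `η = 1 / s` keeps the total loss below one factor `X`. The excess over `X ^ (2s)`
    -- is then `X ^ 3`, paid for by the missing factor `A`.
    have hXs : (X ^ (1 / s : ℝ)) ^ (s - 1) ≤ X := by
      rw [← Real.rpow_natCast, ← Real.rpow_mul hX0.le]
      conv_rhs => rw [← Real.rpow_one X]
      refine Real.rpow_le_rpow_of_exponent_le hX ?_
      rw [div_mul_eq_mul_div, div_le_one hs0, one_mul]
      exact_mod_cast Nat.sub_le _ _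
    have hpow : X ^ 4 * ((X ^ 2) ^ (s - 1) * X) * A ^ (s - 1) ≤ A ^ s * X ^ (2 * s) := by
      have e1 : X ^ 4 * ((X ^ 2) ^ (s - 1) * X) = X ^ 3 * X ^ (2 * s) := by
        rw [← pow_mul, ← pow_succ, ← pow_add, ← pow_add]; congr 1; omega
      have e2 : A ^ s = A * A ^ (s - 1) := by rw [← pow_succ']; congr 1; omega
      have e3 : X ^ 3 ≤ A := (pow_le_pow_right₀ hX (by omega)).trans hA
      rw [e1, e2]
      calc X ^ 3 * X ^ (2 * s) * A ^ (s - 1) ≤ A * X ^ (2 * s) * A ^ (s - 1) := by gcongr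
        _ = _ := by ring
    calc _ ≤ s * (81 * X ^ 4) * ((C₀ * (X ^ 2 * X ^ (1 / s : ℝ))) ^ (s - 1) * (3 * A) ^ (s - 1)) := by
          gcongr
      _ = s * (81 * (C₀ ^ (s - 1) * 3 ^ (s - 1))) *
          (X ^ 4 * ((X ^ 2) ^ (s - 1) * (X ^ (1 / s : ℝ)) ^ (s - 1)) * A ^ (s - 1)) := by
          rw [mul_pow, mul_pow, mul_pow]; ring
      _ ≤ s * (81 * (C₀ ^ (s - 1) * 3 ^ (s - 1))) *
          (X ^ 4 * ((X ^ 2) ^ (s - 1) * X) * A ^ (s - 1)) := by gcongr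
      _ ≤ _ := by gcongr

/-! ### From solutions to families of quadruples. -/

/-- The families of pairs solving one linear equation with coefficients `a`. -/
noncomputable def solutionPairs (d : ℕ) {s : ℕ} (X : ℝ) (a : Fin s → ℤ) :
    Finset (Fin s → ℤ × ℤ) :=
  (Fintype.piFinset fun _ => pairs X).filter fun p => ∑ k, a k * powDiff d (p k) = 0

theorem mem_coeffBox_of_abs_le {s : ℕ} {A : ℝ} {a : Fin s → ℤ} (h : ∀ i, |(a i : ℝ)| ≤ A) :
    a ∈ coeffBox (Fin s) A := by
  rw [coeffBox, Fintype.mem_piFinset]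
  intro i
  rw [Finset.mem_Icc, ← abs_le, Int.le_floor]
  push_cast
  exact h i

/-- For given `a` the two equations are independent copies of one equation, in `(x, z)` and in `(y,
w)`, hence the square; the condition `a i ≠ 0` is dropped. -/
theorem N_le_sum_sq (d s : ℕ) (A X : ℝ) :
    N d s A X ≤ ∑ a ∈ coeffBox (Fin s) A, (solutionPairs d X a).card ^ 2 := by
  classical
  set F := (coeffBox (Fin s) A).sigma fun a => solutionPairs d X a ×ˢ solutionPairs d X a with hF
  have hcard : F.card = ∑ a ∈ coeffBox (Fin s) A, (solutionPairs d X a).card ^ 2 := by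
    rw [hF, Finset.card_sigma]
    exact Finset.sum_congr rfl fun a _ => by rw [Finset.card_product, sq]
  rw [← hcard, N, ← Set.ncard_coe_finset]
  refine Set.ncard_le_ncard_of_injOn
    (fun p => ⟨p.1, fun i => (p.2.1 i, p.2.2.2.1 i), fun i => (p.2.2.1 i, p.2.2.2.2 i)⟩) ?_ ?_
    (Finset.finite_toSet _)
  · rintro ⟨a, x, y, z, w⟩ ⟨ha, hx, hy, hz, hw, h1, h2⟩
    rw [Finset.mem_coe, hF, Finset.mem_sigma, Finset.mem_product, solutionPairs,
      Finset.mem_filter, Finset.mem_filter, Fintype.mem_piFinset, Fintype.mem_piFinset]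
    exact ⟨mem_coeffBox_of_abs_le fun i => (ha i).2,
      ⟨fun i => Finset.mem_product.2 ⟨mem_annulus.2 (hx i), mem_annulus.2 (hz i)⟩, h1⟩,
      ⟨fun i => Finset.mem_product.2 ⟨mem_annulus.2 (hy i), mem_annulus.2 (hw i)⟩, h2⟩⟩
  · rintro ⟨a, x, y, z, w⟩ - ⟨a', x', y', z', w'⟩ - h
    simp only [Sigma.mk.injEq, heq_eq_eq, Prod.mk.injEq] at h
    obtain ⟨rfl, h1, h2⟩ := h
    have h1' := fun i => Prod.mk.injEq _ _ _ _ ▸ congrFun h1 i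
    have h2' := fun i => Prod.mk.injEq _ _ _ _ ▸ congrFun h2 i
    simp only [Prod.mk.injEq, true_and]
    exact ⟨funext fun i => (h1' i).1, funext fun i => (h2' i).1, funext fun i => (h1' i).2,
      funext fun i => (h2' i).2⟩

open Classical in
/-- Solutions with all differences zero contribute the diagonal term; for the others one may
assume that neither vector of differences vanishes. -/
theorem sum_sq_solutionPairs_le {d s : ℕ} (hd : 0 < d) {A X : ℝ} (hA : 1 ≤ A) (hX : 1 ≤ X) :
    ((∑ a ∈ coeffBox (Fin s) A, (solutionPairs d X a).card ^ 2 : ℕ) : ℝ) ≤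
      2 * ((3 * A) ^ s * (6 * X) ^ (2 * s)) +
      2 * ∑ q ∈ (families s X).filter (fun q => (∃ k, powDiff d (q k).1 ≠ 0) ∧
        ∃ k, powDiff d (q k).2 ≠ 0), ((relations d A q).card : ℝ) := by
  set P₀ : Finset (Fin s → ℤ × ℤ) :=
    Fintype.piFinset fun _ => (pairs X).filter fun p => powDiff d p = 0 with hP₀
  set P₁ : (Fin s → ℤ) → Finset (Fin s → ℤ × ℤ) := fun a =>
    (solutionPairs d X a).filter fun p => ∃ k, powDiff d (p k) ≠ 0 with hP₁
  have hsplit : ∀ a, (solutionPairs d X a).card ≤ P₀.card + (P₁ a).card := by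
    intro a
    refine (Finset.card_le_card ?_).trans (Finset.card_union_le _ _)
    intro p hp
    rw [Finset.mem_union]
    by_cases h : ∃ k, powDiff d (p k) ≠ 0
    · right; exact Finset.mem_filter.2 ⟨hp, h⟩
    · left
      push Not at h
      have hp' := Fintype.mem_piFinset.1 (Finset.mem_filter.1 hp).1
      exact Fintype.mem_piFinset.2 fun k => Finset.mem_filter.2 ⟨hp' k, h k⟩
  have hP₀c : (P₀.card : ℝ) ≤ (6 * X) ^ s := by
    rw [hP₀, Fintype.card_piFinset, Finset.prod_const, Finset.card_univ, Fintype.card_fin]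
    push_cast
    exact pow_le_pow_left₀ (by positivity) (card_pairs_powDiff_zero_le hd hX) s
  have hbox : ((coeffBox (Fin s) A).card : ℝ) ≤ (3 * A) ^ s := by
    rw [coeffBox, Fintype.card_piFinset, Finset.prod_const, Finset.card_univ, Fintype.card_fin]
    push_cast
    exact pow_le_pow_left₀ (by positivity) (card_Icc_floor_le hA) s
  have hP₁c : ∑ a ∈ coeffBox (Fin s) A, (P₁ a).card ^ 2 ≤
      ∑ q ∈ (families s X).filter (fun q => (∃ k, powDiff d (q k).1 ≠ 0) ∧
        ∃ k, powDiff d (q k).2 ≠ 0), (relations d A q).card := by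
    have e : ∑ a ∈ coeffBox (Fin s) A, (P₁ a).card ^ 2 =
        ((coeffBox (Fin s) A).sigma fun a => P₁ a ×ˢ P₁ a).card := by
      rw [Finset.card_sigma]
      exact Finset.sum_congr rfl fun a _ => by rw [Finset.card_product, sq]
    rw [e, ← Finset.card_sigma]
    refine Finset.card_le_card_of_injOn (fun x => ⟨fun k => (x.2.1 k, x.2.2 k), x.1⟩) ?_ ?_
    · rintro ⟨a, p, p'⟩ h
      rw [Finset.mem_coe, Finset.mem_sigma, Finset.mem_product] at h
      obtain ⟨ha, hp, hp'⟩ := h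
      obtain ⟨hp1, hp2⟩ := Finset.mem_filter.1 hp
      obtain ⟨hp1', hp2'⟩ := Finset.mem_filter.1 hp'
      obtain ⟨hp3, hp4⟩ := Finset.mem_filter.1 hp1
      obtain ⟨hp3', hp4'⟩ := Finset.mem_filter.1 hp1'
      rw [Fintype.mem_piFinset] at hp3 hp3'
      rw [Finset.mem_coe, Finset.mem_sigma, Finset.mem_filter, families, Fintype.mem_piFinset]
      exact ⟨⟨fun k => Finset.mem_product.2 ⟨hp3 k, hp3' k⟩, hp2, hp2'⟩,
        Finset.mem_filter.2 ⟨ha, hp4, hp4'⟩⟩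
    · rintro ⟨a, p, p'⟩ - ⟨b, r, r'⟩ - h
      simp only [Sigma.mk.injEq, heq_eq_eq] at h
      obtain ⟨h1, rfl⟩ := h
      have h1' := fun i => Prod.mk.injEq _ _ _ _ ▸ congrFun h1 i
      rw [Sigma.mk.injEq]
      exact ⟨rfl, heq_of_eq (Prod.ext (funext fun i => (h1' i).1) (funext fun i => (h1' i).2))⟩
  -- Using `(m + n)² ≤ 2m² + 2n²` avoids the mixed case in which just one of the two component
  -- vectors vanishes.
  calc ((∑ a ∈ coeffBox (Fin s) A, (solutionPairs d X a).card ^ 2 : ℕ) : ℝ)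
      ≤ ((∑ a ∈ coeffBox (Fin s) A, (2 * P₀.card ^ 2 + 2 * (P₁ a).card ^ 2) : ℕ) : ℝ) := by
        refine Nat.cast_le.2 (Finset.sum_le_sum fun a _ => ?_)
        calc (solutionPairs d X a).card ^ 2 ≤ (P₀.card + (P₁ a).card) ^ 2 :=
              Nat.pow_le_pow_left (hsplit a) 2
          _ ≤ _ := by
              have := add_sq_le (a := P₀.card) (b := (P₁ a).card)
              linarith
    _ = 2 * ((coeffBox (Fin s) A).card * (P₀.card : ℝ) ^ 2) +
        2 * ((∑ a ∈ coeffBox (Fin s) A, (P₁ a).card ^ 2 : ℕ) : ℝ) := by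
        rw [Finset.sum_add_distrib, Finset.sum_const, ← Finset.mul_sum]
        push_cast [smul_eq_mul]
        ring
    _ ≤ _ := by
        have h1 : (P₀.card : ℝ) ^ 2 ≤ (6 * X) ^ (2 * s) := by
          rw [mul_comm 2 s, pow_mul]; exact pow_le_pow_left₀ (by positivity) hP₀c 2
        have h2 := (Nat.cast_le (α := ℝ)).2 hP₁c
        rw [Nat.cast_sum (s := (families s X).filter _)] at h2
        gcongr

/-! ### Combining the ranges of `s` and the kinds of families. -/

open Classical in
/-- The bound for the families whose vectors span the plane, in all ranges of `s`. -/
theorem sum_relations_spanning_le {d s : ℕ} (hd : 4 ≤ d) (hs : d + 2 ≤ s) (ε : ℝ) (hε : 0 < ε) :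
    ∃ C : ℝ, 0 ≤ C ∧ ∀ A X : ℝ, 1 ≤ X → X ^ (2 * d) ≤ A →
      ∑ q ∈ (families s X).filter (fun q => ∃ k l, minor d (q k) (q l) ≠ 0),
        ((relations d A q).card : ℝ) ≤
      C * (A ^ s * X ^ (2 * s) + A ^ (s - 1) * X ^ (3 * (s : ℝ) - (d : ℝ) + ε)
          + A ^ (s - 2) * X ^ (4 * (s : ℝ) - 2 * (d : ℝ) + ε)) := by
  -- For `s ≤ 2d` the diagonal term already dominates: `A^(s-2) X^(4s) ≤ A^s X^(2s)`, since `X^(2s)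
  -- ≤ X^(4d) ≤ A²`.
  rcases le_or_gt s (2 * d) with hsd | hsd
  · refine ⟨81 ^ s * 11 ^ (s - 2), by positivity, fun A X hX hA => ?_⟩
    have hX0 : 0 < X := by linarith
    have hA1 : 1 ≤ A := (one_le_pow₀ hX).trans hA
    have hXA : X ^ (2 * s) ≤ A ^ 2 := by
      calc X ^ (2 * s) ≤ X ^ (2 * d * 2) := pow_le_pow_right₀ hX (by omega)
        _ = (X ^ (2 * d)) ^ 2 := pow_mul _ _ _
        _ ≤ _ := by gcongr
    calc _ ≤ ∑ q ∈ (families s X).filter (fun q => ∃ k l, minor d (q k) (q l) ≠ 0),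
          (11 * A) ^ (s - 2) := Finset.sum_le_sum fun q hq =>
          card_relations_le_of_minor_ne_zero (by omega) hA1 hA (Finset.mem_filter.1 hq).1
            (Finset.mem_filter.1 hq).2
      _ = _ * (11 * A) ^ (s - 2) := by rw [Finset.sum_const, nsmul_eq_mul]
      _ ≤ (81 * X ^ 4) ^ s * (11 * A) ^ (s - 2) := by
          gcongr
          exact (Nat.cast_le.2 (Finset.card_filter_le _ _)).trans (card_families_le hX)
      _ = 81 ^ s * 11 ^ (s - 2) * (A ^ (s - 2) * X ^ (2 * s) * X ^ (2 * s)) := by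
          rw [mul_pow, mul_pow, ← pow_mul, show 4 * s = 2 * s + 2 * s by ring, pow_add]; ring
      _ ≤ 81 ^ s * 11 ^ (s - 2) * (A ^ (s - 2) * A ^ 2 * X ^ (2 * s)) := by
          rw [mul_assoc (A ^ (s - 2)) (A ^ 2), mul_assoc (A ^ (s - 2)) (X ^ (2 * s))]
          gcongr
      _ = 81 ^ s * 11 ^ (s - 2) * (A ^ s * X ^ (2 * s)) := by
          rw [← pow_add, Nat.sub_add_cancel (by omega)]
      _ ≤ _ := by
          refine mul_le_mul_of_nonneg_left ?_ (by positivity)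
          have h1 : 0 ≤ A ^ (s - 1) * X ^ (3 * (s : ℝ) - (d : ℝ) + ε) := by positivity
          have h2 : 0 ≤ A ^ (s - 2) * X ^ (4 * (s : ℝ) - 2 * (d : ℝ) + ε) := by positivity
          linarith
  · obtain ⟨C, hC, h⟩ := sum_relations_of_minor_ne_zero_le hd hsd ε hε
    refine ⟨C, hC, fun A X hX hA => (h A X hX hA).trans ?_⟩
    have hX0 : 0 < X := by linarith
    have hA1 : 1 ≤ A := (one_le_pow₀ hX).trans hA
    refine mul_le_mul_of_nonneg_left ?_ hC
    -- One factor `A ≥ X ^ (2d)` is traded in, and `3s + 3 ≤ 2d + (3s - d)`.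
    have h1 : A ^ (s - 2) * X ^ ε * X ^ (3 * s + 3) ≤
        A ^ (s - 1) * X ^ (3 * (s : ℝ) - (d : ℝ) + ε) := by
      have e1 : A ^ (s - 1) = A ^ (s - 2) * A := by rw [← pow_succ]; congr 1; omega
      have e2 : X ^ ε * X ^ (3 * s + 3) ≤ X ^ (2 * d) * X ^ (3 * (s : ℝ) - (d : ℝ) + ε) := by
        rw [← Real.rpow_natCast, ← Real.rpow_natCast, ← Real.rpow_add hX0, ← Real.rpow_add hX0]
        refine Real.rpow_le_rpow_of_exponent_le hX ?_
        have : (4 : ℝ) ≤ d := by exact_mod_cast hd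
        push_cast
        linarith
      rw [e1, mul_assoc, mul_assoc]
      refine mul_le_mul_of_nonneg_left (e2.trans ?_) (by positivity)
      gcongr
    have h2 : A ^ (s - 2) * X ^ ε * X ^ (4 * s - 2 * d) =
        A ^ (s - 2) * X ^ (4 * (s : ℝ) - 2 * (d : ℝ) + ε) := by
      rw [mul_assoc, ← Real.rpow_natCast X, ← Real.rpow_add hX0]
      congr 2
      rw [Nat.cast_sub (by omega)]
      push_cast
      ring
    have h3 : 0 ≤ A ^ s * X ^ (2 * s) := by positivity
    rw [mul_add, h2]
    linarith

end LatticeCount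

theorem lemma3p1 (d s : ℕ) (hd : 4 ≤ d) (hs : d + 2 ≤ s) (ε : ℝ) (hε : 0 < ε) :
    ∃ C : ℝ, 0 < C ∧ ∀ A X : ℝ, 0 < X → 1 ≤ X ^ (2 * d) → X ^ (2 * d) ≤ A →
      (LatticeCount.N d s A X : ℝ) ≤
        C * (A ^ s * X ^ (2 * s)
          + A ^ (s - 1) * X ^ (3 * (s : ℝ) - (d : ℝ) + ε)
          + A ^ (s - 2) * X ^ (4 * (s : ℝ) - 2 * (d : ℝ) + ε) * LatticeCount.E d s X) := by
  classical
  obtain ⟨C₁, hC₁, h₁⟩ := LatticeCount.sum_relations_spanning_le hd hs ε hε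
  obtain ⟨C₂, hC₂, h₂⟩ :=
    LatticeCount.sum_relations_of_minor_eq_zero_le (d := d) (s := s) hd (by omega)
  refine ⟨2 * (3 ^ s * 6 ^ (2 * s)) + 2 * C₂ + 2 * C₁, by positivity, fun A X hX0 hX1 hA => ?_⟩
  have hX : 1 ≤ X := by
    by_contra! h
    exact absurd hX1 (not_le.2 (pow_lt_one₀ hX0.le h (by omega)))
  have hA1 : 1 ≤ A := hX1.trans hA
  set U := A ^ s * X ^ (2 * s) with hU
  set V := A ^ (s - 1) * X ^ (3 * (s : ℝ) - (d : ℝ) + ε) with hV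
  set W := A ^ (s - 2) * X ^ (4 * (s : ℝ) - 2 * (d : ℝ) + ε) with hW
  have hU0 : 0 ≤ U := by positivity
  have hV0 : 0 ≤ V := by positivity
  have hW0 : 0 ≤ W := by positivity
  have hE : 1 ≤ LatticeCount.E d s X := by
    have h1 : 0 < X ^ ((5 * (d : ℝ) + 4 - 2 * (s : ℝ)) / 2) := by positivity
    have h2 : 0 < X ^ (4 * (d : ℝ) + 4 - 2 * (s : ℝ)) := by positivity
    rw [LatticeCount.E]
    linarith
  have hN := ((Nat.cast_le (α := ℝ)).2 (LatticeCount.N_le_sum_sq d s A X)).trans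
    (LatticeCount.sum_sq_solutionPairs_le (by omega) hA1 hX)
  have hsplit : ∑ q ∈ (LatticeCount.families s X).filter
        (fun q => (∃ k, LatticeCount.powDiff d (q k).1 ≠ 0) ∧
          ∃ k, LatticeCount.powDiff d (q k).2 ≠ 0), ((LatticeCount.relations d A q).card : ℝ) ≤
      C₁ * (U + V + W) + C₂ * U := by
    refine le_trans ?_ (add_le_add (h₁ A X hX hA) (h₂ A X hX hA))
    -- Families with a nonzero minor span the plane; the rest are parallel and keep the nonvanishing
    -- of both components.
    rw [← Finset.sum_filter_add_sum_filter_not _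
      (fun q => ∃ k l, LatticeCount.minor d (q k) (q l) ≠ 0)]
    refine add_le_add ?_ ?_
    · refine Finset.sum_le_sum_of_subset_of_nonneg ?_ fun _ _ _ => by positivity
      exact Finset.filter_subset_filter _ (Finset.filter_subset _ _)
    · refine Finset.sum_le_sum_of_subset_of_nonneg ?_ fun _ _ _ => by positivity
      intro q hq
      obtain ⟨hq1, hq2⟩ := Finset.mem_filter.1 hq
      obtain ⟨hq3, hq4⟩ := Finset.mem_filter.1 hq1
      push Not at hq2
      exact Finset.mem_filter.2 ⟨hq3, hq2, hq4⟩
  have e : (3 * A) ^ s * (6 * X) ^ (2 * s) = 3 ^ s * 6 ^ (2 * s) * U := by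
    rw [mul_pow, mul_pow, hU]; ring
  rw [e] at hN
  have hWE : W ≤ W * LatticeCount.E d s X := le_mul_of_one_le_right hW0 hE
  have hc : (0 : ℝ) ≤ 3 ^ s * 6 ^ (2 * s) := by positivity
  calc (LatticeCount.N d s A X : ℝ)
      ≤ 2 * (3 ^ s * 6 ^ (2 * s) * U) + 2 * (C₁ * (U + V + W) + C₂ * U) := by linarith
    _ ≤ (2 * (3 ^ s * 6 ^ (2 * s)) + 2 * C₂ + 2 * C₁) * (U + V + W) := by
        nlinarith [mul_nonneg hc hV0, mul_nonneg hc hW0, mul_nonneg hC₂ hV0, mul_nonneg hC₂ hW0]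
    _ ≤ _ := by gcongr
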